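/- Let $\mathbb{H}=\{z\in\mathbb{C}:\operatorname{Im}z>0\}$ with Lebesgue measure $dv$, and for $\lambda>-1$ let $d\widehat v_\lambda(z)=\frac{\lambda+1}{4\pi}(\operatorname{Im}z)^\lambda\,dv(z)$. Let $\mathcal{A}^2_\lambda(\mathbb{H})$ be the weighted Bergman space of holomorphic functions in $L^2(\mathbb{H},\widehat v_\lambda)$, a closed subspace, let $B_\lambda$ be the orthogonal projection of $L^2(\mathbb{H},\widehat v_\lambda)$ onto it, and for $a\in L^\infty(\mathbb{H})$ let $T^{(\lambda)}_a=B_\lambda M_a$ be the Toeplitz operator on $\mathcal{A}^2_\lambda(\mathbb{H})$. Write $\operatorname{arccot}:\mathbb{R}\to(0,\pi)$, $V(\alpha,\beta)=\int_{\mathbb{R}}e^{-\alpha\operatorname{arccot}u}(1+u^2)^{\beta-1}\,du$ and $F(\xi,u)=(i+u)^{i\xi-\frac{\lambda+2}{2}}$ (argument of $i+u$ in $(0,\pi)$), and put $c=\frac{\lambda+1}{4\pi}$. Let $R_\lambda=W_\lambda^*U_2U_1U_0:L^2(\mathbb{H},\widehat v_\lambda)\to L^2(\mathbb{R})$, where -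 $U_0:L^2(\mathbb{H},\widehat v_\lambda)\to L^2(\mathbb{R}_+\times\mathbb{R},\,c\,s^{1+\lambda}\,ds\,dh)$, $(U_0g)(s,h)=g(s(h+i))$; - $U_1:L^2(\mathbb{R}_+\times\mathbb{R},\,c\,s^{1+\lambda}\,ds\,dh)\to L^2(\mathbb{R}\times\mathbb{R},\,c\,d\xi\,dh)$ is the continuous extension of the Mellin transform in $s$, $(U_1\varphi)(\xi,h)=\frac{1}{\sqrt{2\pi}}\int_0^\infty\varphi(s,h)\,s^{\frac{\lambda}{2}-i\xi}\,ds$; - $U_2:L^2(\mathbb{R}\times\mathbb{R},\,c\,d\xi\,du)\to L^2(\mathbb{R}\times\mathbb{R},\,c\,|F|^2\,d\xi\,du)$, $U_2\varphi=\varphi/F$; - $W_\lambda:L^2(\mathbb{R})\to L^2(\mathbb{R}\times\mathbb{R},\,c\,|F|^2\,d\xi\,du)$ is the isometry $(W_\lambda\psi)(\xi,u)=\sqrt{\frac{4\pi}{(\lambda+1)V(2\xi,-\lambda/2)}}\;\psi(\xi)$. **Corollary.** Let $a\in L^\infty(\mathbb{H})$ be a hyperbolic symbol, i.e. for every $s>0$,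 $a(sz)=a(z)$ for almost every $z\in\mathbb{H}$. Then there is a measurable $f:\mathbb{R}\to\mathbb{C}$ with $$a(z)=f\!\left(\frac{\operatorname{Re}z}{\operatorname{Im}z}\right)\quad\text{for almost every }z\in\mathbb{H},$$ and for every such $f$ and every $\lambda>-1$ the following hold. The operator $R_\lambda$ is a surjective partial isometry with initial space $\mathcal{A}^2_\lambda(\mathbb{H})$, that is, $R_\lambda^*R_\lambda=B_\lambda$ and $R_\lambda R_\lambda^*=I$; so it restricts to a unitary operator $\mathcal{A}^2_\lambda(\mathbb{H})\to L^2(\mathbb{R})$. Moreover $$R_\lambda\circ T^{(\lambda)}_a\circ R_\lambda^*=M_{\gamma_{a,\lambda}},$$ the operator on $L^2(\mathbb{R})$ of multiplication by the bounded function $$\gamma_{a,\lambda}(\xi)=\frac{1}{V\!\left(2\xi,-\frac{\lambda}{2}\right)}\int_{\mathbb{R}}\frac{e^{-2\xi\operatorname{arccot}u}}{(1+u^2)^{\frac{\lambda}{2}+1}}f(u)\,du=\frac{\displaystyle\int_{\mathbb{R}}\frac{e^{-2\xi\operatorname{arccot}u}}{(1+u^2)^{\frac{\lambda}{2}+1}}f(u)\,du}{\displaystyle\int_{\mathbb{R}}\frac{e^{-2\xi\operatorname{arccot}u}}{(1+u^2)^{\frac{\lambda}{2}+1}}\,du},\qquad\xi\in\mathbb{R},$$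 where all integrals converge absolutely and $V(2\xi,-\frac{\lambda}{2})>0$. -/

import Mathlib

open MeasureTheory Set Filter Complex
open scoped ENNReal NNReal Topology

noncomputable section

namespace HyperbolicToeplitz

/-- The normalizing constant `c_λ = Γ(λ + 2) / (π Γ(λ + 1)) = (λ + 1) / π`. -/
def cConst (lam : ℝ) : ℝ := (lam + 1) / Real.pi

/-- The upper half-plane, as a subset of `ℂ`. -/
abbrev H : Set ℂ := UpperHalfPlane.upperHalfPlaneSet

/-- The weighted measure `(c_λ / 4) (Im z) ^ λ dv(z)` on the upper half-plane (extended by zero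
to `ℂ`). -/
def vHat (lam : ℝ) : Measure ℂ :=
  (volume.restrict H).withDensity fun z => ENNReal.ofReal (cConst lam / 4 * z.im ^ lam)

/-- The branch of `arccot` on `ℝ` with values in `(0, π)`. -/
def arccot (u : ℝ) : ℝ := Real.pi / 2 - Real.arctan u

/-- The Romanovski-Routh weight `exp (-α arccot u) / (1 + u²) ^ (1 - β)`. -/
def rrWeight (α β u : ℝ) : ℝ := Real.exp (-α * arccot u) / (1 + u ^ 2) ^ (1 - β)

/-- The total mass `V(α, β)` of the Romanovski-Routh weight. -/
def V (α β : ℝ) : ℝ := ∫ u : ℝ, rrWeight α β u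

/-- `F(ξ, u) = (i + u) ^ (iξ - (λ + 2) / 2)`.  As `i + u` lies in the upper half-plane, the
principal branch used here agrees with the branch having arguments in `(0, 2π)`. -/
def F (lam : ℝ) (p : ℝ × ℝ) : ℂ := (I + (p.2 : ℂ)) ^ (I * (p.1 : ℂ) - ((lam : ℂ) + 2) / 2)

lemma cConst_pos {lam : ℝ} (h : -1 < lam) : 0 < cConst lam :=
  div_pos (by linarith) Real.pi_pos

lemma I_add_ne_zero (u : ℝ) : I + (u : ℂ) ≠ 0 := by
  intro h
  have := congrArg Complex.im h
  simp at this

lemma arg_I_add (u : ℝ) : Complex.arg (I + (u : ℂ)) = arccot u := by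
  have hr : 0 < ‖I + (u : ℂ)‖ := norm_pos_iff.2 (I_add_ne_zero u)
  have hs : 0 < Real.sqrt (1 + u ^ 2) := Real.sqrt_pos.2 (by positivity)
  have hn : ‖I + (u : ℂ)‖ = Real.sqrt (1 + u ^ 2) := by
    rw [Complex.norm_eq_sqrt_sq_add_sq]; simp [add_comm]
  have h1 := Real.neg_pi_div_two_lt_arctan u
  have h2 := Real.arctan_lt_pi_div_two u
  have : I + (u : ℂ) = (Real.sqrt (1 + u ^ 2) : ℝ) *
      (Complex.cos (arccot u : ℝ) + Complex.sin (arccot u : ℝ) * I) := by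
    rw [← Complex.ofReal_cos, ← Complex.ofReal_sin, arccot, Real.cos_pi_div_two_sub,
      Real.sin_pi_div_two_sub, Real.sin_arctan, Real.cos_arctan]
    apply Complex.ext
    · simp; field_simp
    · simp; field_simp
  rw [this, Complex.arg_mul_cos_add_sin_mul_I hs]
  unfold arccot
  constructor <;> linarith [Real.pi_pos]

lemma norm_F_sq (lam ξ u : ℝ) : ‖F lam (ξ, u)‖ ^ 2 = rrWeight (2 * ξ) (-lam / 2) u := by
  have hn : ‖I + (u : ℂ)‖ = (1 + u ^ 2) ^ (1 / 2 : ℝ) := by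
    rw [Complex.norm_eq_sqrt_sq_add_sq, Real.sqrt_eq_rpow]; simp [add_comm]
  have hp : (0 : ℝ) < 1 + u ^ 2 := by positivity
  unfold F rrWeight
  rw [Complex.norm_cpow_of_ne_zero (I_add_ne_zero u), arg_I_add, hn]
  have e1 : (I * ((ξ, u) : ℝ × ℝ).1 - ((lam : ℂ) + 2) / 2).re = -(lam + 2) / 2 := by
    simp; ring
  have e2 : (I * ((ξ, u) : ℝ × ℝ).1 - ((lam : ℂ) + 2) / 2).im = ξ := by simp
  rw [e1, e2, div_pow, ← Real.rpow_mul hp.le, ← Real.rpow_mul_natCast hp.le, ← Real.exp_nat_mul,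
    div_eq_mul_inv, ← Real.exp_neg, div_eq_mul_inv (Real.exp (-(2 * ξ) * arccot u)),
    ← Real.rpow_neg hp.le, mul_comm]
  congr 1
  · congr 1; push_cast; ring
  · congr 1; push_cast; ring

lemma F_ne_zero (lam : ℝ) (p : ℝ × ℝ) : F lam p ≠ 0 := by
  unfold F
  rw [Ne, Complex.cpow_eq_zero_iff]
  exact fun h => I_add_ne_zero _ h.1

lemma measurable_F (lam : ℝ) : Measurable (F lam) := by
  unfold F; fun_prop

lemma continuous_arccot : Continuous arccot := by unfold arccot; fun_prop

lemma arccot_pos (u : ℝ) : 0 < arccot u := by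
  unfold arccot; linarith [Real.arctan_lt_pi_div_two u]

lemma arccot_lt_pi (u : ℝ) : arccot u < Real.pi := by
  unfold arccot; linarith [Real.neg_pi_div_two_lt_arctan u]

lemma rrWeight_pos (α β u : ℝ) : 0 < rrWeight α β u := by unfold rrWeight; positivity

lemma measurable_rrWeight (β : ℝ) : Measurable fun p : ℝ × ℝ => rrWeight (2 * p.1) β p.2 := by
  have := continuous_arccot.measurable
  unfold rrWeight; fun_prop

lemma integrable_rrWeight (α : ℝ) {β : ℝ} (hβ : β < 1 / 2) : Integrable (rrWeight α β) := by
  have h0 : Integrable (fun u : ℝ => ((1 : ℝ) + ‖u‖ ^ 2) ^ (-(2 - 2 * β) / 2)) :=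
    integrable_rpow_neg_one_add_norm_sq (by simp; linarith)
  refine (h0.const_mul (Real.exp (|α| * Real.pi))).mono' ?_ (Eventually.of_forall fun u => ?_)
  · have := continuous_arccot.measurable
    unfold rrWeight
    exact Measurable.aestronglyMeasurable (by fun_prop)
  · rw [Real.norm_of_nonneg (rrWeight_pos _ _ _).le]
    unfold rrWeight
    have hp : (0 : ℝ) < 1 + u ^ 2 := by positivity
    rw [div_eq_mul_inv, ← Real.rpow_neg hp.le, Real.norm_eq_abs, sq_abs,
      show -(1 - β) = -(2 - 2 * β) / 2 by ring]
    refine mul_le_mul_of_nonneg_right (Real.exp_le_exp.2 ?_) (by positivity)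
    calc -α * arccot u ≤ |-α * arccot u| := le_abs_self _
      _ = |α| * arccot u := by rw [abs_mul, abs_neg, abs_of_pos (arccot_pos u)]
      _ ≤ |α| * Real.pi := by exact mul_le_mul_of_nonneg_left (arccot_lt_pi u).le (abs_nonneg _)

lemma V_pos (α : ℝ) {β : ℝ} (hβ : β < 1 / 2) : 0 < V α β := by
  unfold V
  rw [integral_pos_iff_support_of_nonneg (fun u => (rrWeight_pos α β u).le)
    (integrable_rrWeight α hβ)]
  have : Function.support (rrWeight α β) = univ := by
    ext u; simp [(rrWeight_pos α β u).ne']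
  simp [this]

section General

variable {α β : Type*} [MeasurableSpace α] [MeasurableSpace β] {μ : Measure α} {ν : Measure β}

lemma eLpNorm_two_eq_of_lintegral {f : α → ℂ} {g : β → ℂ}
    (h : ∫⁻ x, ‖f x‖ₑ ^ 2 ∂μ = ∫⁻ y, ‖g y‖ₑ ^ 2 ∂ν) : eLpNorm f 2 μ = eLpNorm g 2 ν := by
  rw [eLpNorm_eq_lintegral_rpow_enorm_toReal (by norm_num) (by norm_num),
    eLpNorm_eq_lintegral_rpow_enorm_toReal (by norm_num) (by norm_num)]
  simp only [ENNReal.toReal_ofNat, ENNReal.rpow_ofNat, h]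

/-- A linear map between spaces of functions that respects almost everywhere equality and
measurability and preserves `∫ |f|²` induces a linear isometry between the `L²` spaces. -/
def isometryOfFun (Φ : (α → ℂ) → β → ℂ) (hadd : ∀ f g, Φ (f + g) = Φ f + Φ g)
    (hsmul : ∀ (c : ℂ) f, Φ (c • f) = c • Φ f)
    (hcongr : ∀ f g, f =ᵐ[μ] g → Φ f =ᵐ[ν] Φ g)
    (hmeas : ∀ f, AEStronglyMeasurable f μ → AEStronglyMeasurable (Φ f) ν)
    (hnorm : ∀ f, AEStronglyMeasurable f μ →
      ∫⁻ y, ‖Φ f y‖ₑ ^ 2 ∂ν = ∫⁻ x, ‖f x‖ₑ ^ 2 ∂μ) :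
    Lp ℂ 2 μ →ₗᵢ[ℂ] Lp ℂ 2 ν :=
  have hn : ∀ f, AEStronglyMeasurable f μ → eLpNorm (Φ f) 2 ν = eLpNorm f 2 μ :=
    fun f hf => eLpNorm_two_eq_of_lintegral (hnorm f hf)
  have hmem : ∀ f : Lp ℂ 2 μ, MemLp (Φ f) 2 ν := fun f =>
    ⟨hmeas f (Lp.aestronglyMeasurable f), by
      rw [hn f (Lp.aestronglyMeasurable f)]; exact Lp.eLpNorm_lt_top f⟩
  { toFun := fun f => (hmem f).toLp (Φ f)
    map_add' := fun f g => by
      rw [← MemLp.toLp_add, MemLp.toLp_eq_toLp_iff, ← hadd]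
      exact hcongr _ _ (Lp.coeFn_add f g)
    map_smul' := fun c f => by
      rw [RingHom.id_apply, ← MemLp.toLp_const_smul, MemLp.toLp_eq_toLp_iff, ← hsmul]
      exact hcongr _ _ (Lp.coeFn_smul c f)
    norm_map' := fun f => by
      simp only [LinearMap.coe_mk, AddHom.coe_mk]
      rw [Lp.norm_toLp, Lp.norm_def, hn f (Lp.aestronglyMeasurable f)] }

lemma coeFn_isometryOfFun (Φ : (α → ℂ) → β → ℂ) (hadd : ∀ f g, Φ (f + g) = Φ f + Φ g)
    (hsmul : ∀ (c : ℂ) f, Φ (c • f) = c • Φ f)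
    (hcongr : ∀ f g, f =ᵐ[μ] g → Φ f =ᵐ[ν] Φ g)
    (hmeas : ∀ f, AEStronglyMeasurable f μ → AEStronglyMeasurable (Φ f) ν)
    (hnorm : ∀ f, AEStronglyMeasurable f μ →
      ∫⁻ y, ‖Φ f y‖ₑ ^ 2 ∂ν = ∫⁻ x, ‖f x‖ₑ ^ 2 ∂μ) (f : Lp ℂ 2 μ) :
    isometryOfFun Φ hadd hsmul hcongr hmeas hnorm f =ᵐ[ν] Φ f :=
  MemLp.coeFn_toLp (f := Φ f) (p := 2) (μ := ν) ⟨hmeas f (Lp.aestronglyMeasurable f), by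
    rw [eLpNorm_two_eq_of_lintegral (hnorm f (Lp.aestronglyMeasurable f))]
    exact Lp.eLpNorm_lt_top f⟩

/-- The multiplication operator `M_g` on `L²(μ)` of an essentially bounded function `g`. -/
def mulOp (g : α → ℂ) (hg : MemLp g ∞ μ) : Lp ℂ 2 μ →L[ℂ] Lp ℂ 2 μ :=
  ((ContinuousLinearMap.mul ℂ ℂ).holderL μ ∞ 2 2) (hg.toLp g)

lemma coeFn_mulOp (g : α → ℂ) (hg : MemLp g ∞ μ) (f : Lp ℂ 2 μ) :
    mulOp g hg f =ᵐ[μ] fun x => g x * f x := by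
  filter_upwards [(ContinuousLinearMap.mul ℂ ℂ).coeFn_holder (r := 2) (hg.toLp g) f,
    hg.coeFn_toLp] with x h1 h2
  rw [← h2]
  exact h1

end General

/-- The measure `s ^ (1 + λ) ds` on `(0, ∞)`. -/
def radialMeasure (lam : ℝ) : Measure ℝ :=
  (volume.restrict (Ioi 0)).withDensity fun s => ENNReal.ofReal (s ^ (1 + lam))

/-- The measure `(c_λ / 4) dh` on `ℝ`. -/
def momentMeasure (lam : ℝ) : Measure ℝ := ENNReal.ofReal (cConst lam / 4) • volume

instance (lam : ℝ) : SFinite (radialMeasure lam) := by unfold radialMeasure; infer_instance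

instance (lam : ℝ) : SFinite (momentMeasure lam) := by unfold momentMeasure; infer_instance

/-- The measure `(c_λ / 4) s ^ (1 + λ) ds dh` on `(0, ∞) × ℝ`, which is the weighted measure of the
half-plane in the group-moment coordinates `(s, h)`. -/
def nuHat (lam : ℝ) : Measure (ℝ × ℝ) := (radialMeasure lam).prod (momentMeasure lam)

/-- The measure `(c_λ / 4) dξ dh` on `ℝ × ℝ`. -/
def rho (lam : ℝ) : Measure (ℝ × ℝ) := volume.prod (momentMeasure lam)

/-- The measure `(c_λ / 4) |F(ξ, u)|² dξ du` on `ℝ × ℝ`. -/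
def rhoF (lam : ℝ) : Measure (ℝ × ℝ) :=
  (rho lam).withDensity fun p => ENNReal.ofReal (‖F lam p‖ ^ 2)

/-- The group-moment coordinates `κ(s, h) = s (h + i)` of the half-plane. -/
def kappa (p : ℝ × ℝ) : ℂ := (p.1 : ℂ) * ((p.2 : ℂ) + I)

lemma measurable_kappa : Measurable kappa := by unfold kappa; fun_prop

lemma lintegral_momentMeasure (lam : ℝ) (g : ℝ → ℝ≥0∞) :
    ∫⁻ h, g h ∂(momentMeasure lam) = ENNReal.ofReal (cConst lam / 4) * ∫⁻ h, g h := by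
  unfold momentMeasure; rw [lintegral_smul_measure]; rfl

lemma lintegral_radialMeasure (lam : ℝ) {g : ℝ → ℝ≥0∞} :
    ∫⁻ s, g s ∂(radialMeasure lam) = ∫⁻ s in Ioi 0, ENNReal.ofReal (s ^ (1 + lam)) * g s := by
  unfold radialMeasure
  rw [lintegral_withDensity_eq_lintegral_mul_non_measurable _ (by fun_prop)
    (Eventually.of_forall fun _ => ENNReal.ofReal_lt_top)]
  rfl

lemma lintegral_H {g : ℂ → ℝ≥0∞} (hg : Measurable g) :
    ∫⁻ z in H, g z = ∫⁻ s in Ioi 0, ENNReal.ofReal s * ∫⁻ h, g (kappa (s, h)) := by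
  have hm : MeasurableSet H := UpperHalfPlane.isOpen_upperHalfPlaneSet.measurableSet
  rw [← lintegral_indicator hm,
    ← (Complex.volume_preserving_equiv_real_prod.symm).lintegral_comp
      (hg.indicator hm), Measure.volume_eq_prod,
    lintegral_prod_symm' (fun a => H.indicator g (measurableEquivRealProd.symm a))
      ((hg.indicator hm).comp (MeasurableEquiv.measurable _)),
    ← lintegral_indicator measurableSet_Ioi]
  refine lintegral_congr fun y => ?_
  by_cases hy : 0 < y
  · have : y ∈ Ioi (0 : ℝ) := hy
    rw [indicator_of_mem this, ← lintegral_const_mul' _ _ ENNReal.ofReal_ne_top]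
    have key := lintegral_image_eq_lintegral_abs_deriv_mul (s := univ) (f := fun h : ℝ => y * h)
      (f' := fun _ => y) MeasurableSet.univ
      (fun x _ => ((hasDerivAt_id x).const_mul y |>.congr_deriv (by simp)).hasDerivWithinAt)
      (fun a _ b _ hab => mul_left_cancel₀ hy.ne' hab)
      (fun x => g (Complex.measurableEquivRealProd.symm (x, y)))
    rw [image_univ, (mul_left_surjective₀ hy.ne').range_eq, setLIntegral_univ,
      setLIntegral_univ] at key
    rw [abs_of_pos hy] at key
    refine Eq.trans (lintegral_congr fun x => ?_) (key.trans (lintegral_congr fun x => ?_))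
    · rw [indicator_of_mem]
      simpa [H, Complex.measurableEquivRealProd, Complex.equivRealProd] using hy
    · congr 2
      apply Complex.ext <;>
        simp [kappa, Complex.measurableEquivRealProd]
  · rw [indicator_of_notMem (by simpa using hy)]
    rw [lintegral_eq_zero_iff (by
      exact ((hg.indicator hm).comp (MeasurableEquiv.measurable _)).comp (by fun_prop))]
    refine Eventually.of_forall fun x => ?_
    simp only [Pi.zero_apply]
    rw [indicator_of_notMem]
    simpa [H, Complex.measurableEquivRealProd, Complex.equivRealProd] using hy

lemma measurePreserving_kappa {lam : ℝ} (hlam : -1 < lam) :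
    MeasurePreserving kappa (nuHat lam) (vHat lam) := by
  refine ⟨measurable_kappa, ?_⟩
  have hc : 0 ≤ cConst lam / 4 := (div_pos (cConst_pos hlam) (by norm_num)).le
  have hm : Measurable fun z : ℂ => ENNReal.ofReal (cConst lam / 4 * z.im ^ lam) := by fun_prop
  refine Measure.ext_of_lintegral _ fun g hg => ?_
  rw [lintegral_map hg measurable_kappa, vHat, lintegral_withDensity_eq_lintegral_mul _ hm hg,
    lintegral_H (hm.mul hg), nuHat, lintegral_prod (fun a => g (kappa a)) (hg.comp measurable_kappa).aemeasurable,
    lintegral_radialMeasure]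
  refine setLIntegral_congr_fun measurableSet_Ioi fun s hs => ?_
  have hs : 0 < s := hs
  simp only [Pi.mul_apply]
  have him : ∀ h : ℝ, (kappa (s, h)).im = s := fun h => by simp [kappa]
  simp only [him]
  rw [lintegral_momentMeasure, lintegral_const_mul' _ _ ENNReal.ofReal_ne_top, ← mul_assoc,
    ← mul_assoc, ← ENNReal.ofReal_mul (by positivity), ← ENNReal.ofReal_mul (by positivity),
    Real.rpow_add hs, Real.rpow_one]
  congr 2
  ring

/-- `U₀ f = f ∘ κ`. -/
def U0 (lam : ℝ) [hlam : Fact (-1 < lam)] : Lp ℂ 2 (vHat lam) →ₗᵢ[ℂ] Lp ℂ 2 (nuHat lam) :=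
  Lp.compMeasurePreservingₗᵢ ℂ kappa (measurePreserving_kappa hlam.out)

/-- `(U₂ φ)(ξ, u) = φ(ξ, u) / F(ξ, u)`. -/
def U2 (lam : ℝ) : Lp ℂ 2 (rho lam) →ₗᵢ[ℂ] Lp ℂ 2 (rhoF lam) :=
  isometryOfFun (fun φ p => φ p / F lam p)
    (fun f g => by ext p; simp [add_div])
    (fun c f => by ext p; simp [mul_div_assoc])
    (fun f g hfg => (withDensity_absolutelyContinuous _ _).ae_le
      (by filter_upwards [hfg] with p hp; rw [hp]))
    (fun f hf => (hf.mono_ac (withDensity_absolutelyContinuous _ _)).mul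
      (measurable_F lam).inv.aestronglyMeasurable)
    (fun f hf => by
      have hm : Measurable fun p => ENNReal.ofReal (‖F lam p‖ ^ 2) := by
        have := measurable_F lam; fun_prop
      rw [rhoF, lintegral_withDensity_eq_lintegral_mul_non_measurable _ hm
        (Eventually.of_forall fun _ => ENNReal.ofReal_lt_top)]
      refine lintegral_congr fun p => ?_
      have h0 : ‖F lam p‖ₑ ≠ 0 := by simpa using F_ne_zero lam p
      rw [Pi.mul_apply, ENNReal.ofReal_pow (norm_nonneg _), ofReal_norm, ← mul_pow,
        ← enorm_mul, mul_div_cancel₀ _ (F_ne_zero lam p)])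

/-- `W_λ : L²(ℝ) → L²(ℝ × ℝ, (c_λ / 4) |F|² dξ du)`,
`(W_λ ψ)(ξ, u) = √(2 (2π) / ((λ + 1) V(2ξ, -λ/2))) ψ(ξ)`. -/
def W (lam : ℝ) [hlam : Fact (-1 < lam)] :
    Lp ℂ 2 (volume : Measure ℝ) →ₗᵢ[ℂ] Lp ℂ 2 (rhoF lam) :=
  have hV : Measurable fun ξ => V (2 * ξ) (-lam / 2) :=
    (StronglyMeasurable.integral_prod_right'
      (measurable_rrWeight (-lam / 2)).stronglyMeasurable).measurable
  have hac : rhoF lam ≪ rho lam := withDensity_absolutelyContinuous _ _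
  have hq : Measure.QuasiMeasurePreserving Prod.fst (rho lam) volume :=
    Measure.quasiMeasurePreserving_fst
  isometryOfFun (fun ψ p =>
      (Real.sqrt (2 * (2 * Real.pi) / ((lam + 1) * V (2 * p.1) (-lam / 2))) : ℂ) * ψ p.1)
    (fun f g => by ext p; simp [mul_add])
    (fun c f => by ext p; simp [mul_left_comm])
    (fun f g hfg => hac.ae_le
      (by filter_upwards [hq.ae_eq_comp hfg] with p hp; simp at hp; rw [hp]))
    (fun f hf => by
      refine AEStronglyMeasurable.mul ?_ ((hf.comp_quasiMeasurePreserving hq).mono_ac hac)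
      have : Measurable fun p : ℝ × ℝ => V (2 * p.1) (-lam / 2) := hV.comp measurable_fst
      exact Measurable.aestronglyMeasurable (by fun_prop))
    (fun f hf => by
      have hl : 0 < lam + 1 := by linarith [hlam.out]
      have hβ : -lam / 2 < 1 / 2 := by linarith
      have hm : Measurable fun p => ENNReal.ofReal (‖F lam p‖ ^ 2) := by
        have := measurable_F lam; fun_prop
      rw [rhoF, lintegral_withDensity_eq_lintegral_mul_non_measurable _ hm
        (Eventually.of_forall fun _ => ENNReal.ofReal_lt_top), rho, lintegral_prod]
      · refine lintegral_congr fun ξ => ?_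
        have hVp := V_pos (2 * ξ) hβ
        rw [lintegral_momentMeasure]
        simp only [Pi.mul_apply, norm_F_sq]
        rw [lintegral_mul_const' _ _ (ENNReal.pow_ne_top enorm_ne_top), ← ofReal_integral_eq_lintegral_ofReal
          (integrable_rrWeight _ hβ) (Eventually.of_forall fun u => (rrWeight_pos _ _ u).le)]
        change _ * (ENNReal.ofReal (V (2 * ξ) (-lam / 2)) * _) = _
        rw [enorm_mul, mul_pow, ← ofReal_norm, ← ENNReal.ofReal_pow (norm_nonneg _),
          Complex.norm_real, Real.norm_eq_abs, sq_abs, Real.sq_sqrt (by positivity), ← mul_assoc,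
          ← mul_assoc, ← ENNReal.ofReal_mul (by unfold cConst; positivity),
          ← ENNReal.ofReal_mul (by unfold cConst; positivity)]
        have : cConst lam / 4 * V (2 * ξ) (-lam / 2) *
            (2 * (2 * Real.pi) / ((lam + 1) * V (2 * ξ) (-lam / 2))) = 1 := by
          have := hVp.ne'
          unfold cConst; generalize V (2 * ξ) (-lam / 2) = v at *; field_simp; norm_num
        rw [this]; simp
      · refine hm.aemeasurable.mul (AEMeasurable.pow_const ?_ _)
        refine AEStronglyMeasurable.enorm (AEStronglyMeasurable.mul ?_
          (hf.comp_quasiMeasurePreserving hq))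
        have : Measurable fun p : ℝ × ℝ => V (2 * p.1) (-lam / 2) := hV.comp measurable_fst
        exact Measurable.aestronglyMeasurable (by fun_prop))

lemma enorm_le_circle {G : ℂ → ℂ} {w : ℂ} {ρ : ℝ} (hρ : 0 < ρ)
    (hG : DiffContOnCl ℂ G (Metric.ball w ρ)) :
    ENNReal.ofReal (2 * Real.pi) * ‖G w‖ₑ ≤
      ∫⁻ θ in Ioo (-Real.pi) Real.pi, ‖G (w + ρ * (Real.cos θ + Real.sin θ * I))‖ₑ := by
  have h1 : Real.circleAverage G w ρ = G w :=
    DiffContOnCl.circleAverage (by rwa [abs_of_pos hρ])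
  have h2 : ∫ θ in (-Real.pi)..Real.pi, G (circleMap w ρ θ) = (2 * Real.pi : ℂ) * G w := by
    have hp : Function.Periodic (fun θ => G (circleMap w ρ θ)) (2 * Real.pi) :=
      (periodic_circleMap w ρ).comp G
    have := hp.intervalIntegral_add_eq (-Real.pi) 0
    rw [zero_add, show -Real.pi + 2 * Real.pi = Real.pi by ring] at this
    rw [this, ← h1, Real.circleAverage, Complex.real_smul]
    push_cast
    field_simp
  have h3 : ENNReal.ofReal (2 * Real.pi) * ‖G w‖ₑ
      = ‖∫ θ in (-Real.pi)..Real.pi, G (circleMap w ρ θ)‖ₑ := by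
    rw [h2, enorm_mul]
    congr 1
    rw [← ofReal_norm]; congr 1
    simp [abs_of_pos Real.pi_pos]
  rw [h3, intervalIntegral.integral_of_le (by linarith [Real.pi_pos]),
    restrict_Ioo_eq_restrict_Ioc]
  refine (enorm_integral_le_lintegral_enorm _).trans (le_of_eq (lintegral_congr fun θ => ?_))
  rw [circleMap, Complex.exp_mul_I]
  simp

lemma enorm_le_ball {G : ℂ → ℂ} (hGm : Measurable G) {w : ℂ} {r : ℝ} (hr : 0 < r)
    (hG : DifferentiableOn ℂ G (Metric.ball w r)) :
    ENNReal.ofReal (r / 2) * ENNReal.ofReal (r / 2) * ENNReal.ofReal (2 * Real.pi) * ‖G w‖ₑ ≤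
      ∫⁻ z in Metric.ball w r, ‖G z‖ₑ := by
  have hms : MeasurableSet (Metric.ball w r) := Metric.isOpen_ball.measurableSet
  set f : ℂ → ℝ≥0∞ := (Metric.ball w r).indicator fun z => ‖G z‖ₑ with hf
  have hfm : Measurable f := hGm.enorm.indicator hms
  have htr : ∫⁻ z in Metric.ball w r, ‖G z‖ₑ = ∫⁻ z, f (w + z) := by
    rw [lintegral_add_left_eq_self f w, lintegral_indicator hms]
  rw [htr, ← Complex.lintegral_comp_polarCoord_symm, polarCoord_target, Measure.volume_eq_prod,
    ← Measure.prod_restrict]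
  have hm : Measurable fun p : ℝ × ℝ =>
      ENNReal.ofReal p.1 * f (w + Complex.polarCoord.symm p) := by
    have : Measurable fun p : ℝ × ℝ => Complex.polarCoord.symm p := by
      simp only [Complex.polarCoord_symm_apply]; fun_prop
    fun_prop
  simp only [smul_eq_mul]
  rw [lintegral_prod _ hm.aemeasurable]
  calc _ = ∫⁻ _ in Ioo (r / 2) r, ENNReal.ofReal (r / 2) *
        (ENNReal.ofReal (2 * Real.pi) * ‖G w‖ₑ) := by
        rw [setLIntegral_const, Real.volume_Ioo, show r - r / 2 = r / 2 by ring]; ring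
    _ ≤ ∫⁻ ρ in Ioo (r / 2) r, ∫⁻ θ in Ioo (-Real.pi) Real.pi,
          ENNReal.ofReal ρ * f (w + Complex.polarCoord.symm (ρ, θ)) := by
        refine setLIntegral_mono' measurableSet_Ioo fun ρ hρ => ?_
        have hρ0 : 0 < ρ := by linarith [hρ.1]
        rw [lintegral_const_mul' _ _ ENNReal.ofReal_ne_top]
        refine mul_le_mul' (ENNReal.ofReal_le_ofReal hρ.1.le) ?_
        have hd : DiffContOnCl ℂ G (Metric.ball w ρ) :=
          (hG.mono (Metric.closedBall_subset_ball hρ.2)).diffContOnCl_ball (le_refl _)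
        refine (enorm_le_circle hρ0 hd).trans (le_of_eq (lintegral_congr fun θ => ?_))
        rw [hf, indicator_of_mem]
        · rw [Complex.polarCoord_symm_apply]
        · rw [Complex.polarCoord_symm_apply, mem_ball_iff_norm, add_sub_cancel_left,
            norm_mul, Complex.norm_real, Complex.ofReal_cos, Complex.ofReal_sin, Complex.norm_cos_add_sin_mul_I]
          simpa [abs_of_pos hρ0] using hρ.2
    _ ≤ _ := lintegral_mono_set fun x hx => by
        have := hx.1
        simp only [mem_Ioi]; linarith

/-- Point evaluations of holomorphic functions are locally uniformly bounded by the `L²` norm. -/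
lemma enorm_le_eLpNorm {lam : ℝ} (hlam : -1 < lam) {z₀ : ℂ} (hz : z₀ ∈ H) :
    ∃ r > 0, ∃ C : ℝ≥0∞, C ≠ ∞ ∧ Metric.ball z₀ r ⊆ H ∧ ∀ g : ℂ → ℂ, DifferentiableOn ℂ g H →
      ∀ w ∈ Metric.ball z₀ r, ‖g w‖ₑ ≤ C * eLpNorm g 2 (vHat lam) := by
  have hm : MeasurableSet H := UpperHalfPlane.isOpen_upperHalfPlaneSet.measurableSet
  have hz : 0 < z₀.im := hz
  set y := z₀.im with hy
  have him : ∀ w ∈ Metric.ball z₀ (y / 2), y / 2 < w.im ∧ w.im < 2 * y := fun w hw => by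
    have h1 : |(w - z₀).im| ≤ ‖w - z₀‖ := Complex.abs_im_le_norm _
    have h2 := mem_ball_iff_norm.1 hw
    have h3 := abs_lt.1 (h1.trans_lt h2)
    simp only [Complex.sub_im] at h3
    constructor <;> linarith [h3.1, h3.2]
  have hball : Metric.ball z₀ (y / 2) ⊆ H := fun w hw => by
    have := (him w hw).1
    have : 0 < w.im := by linarith
    exact this
  -- the density is bounded below on the ball
  obtain ⟨δ, hδ, hδle⟩ : ∃ δ > 0, ∀ w ∈ Metric.ball z₀ (y / 2),
      δ ≤ cConst lam / 4 * w.im ^ lam := by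
    have hc : 0 < cConst lam / 4 := div_pos (cConst_pos hlam) (by norm_num)
    refine ⟨cConst lam / 4 * min ((y / 2) ^ lam) ((2 * y) ^ lam), by positivity, fun w hw => ?_⟩
    refine mul_le_mul_of_nonneg_left ?_ hc.le
    obtain ⟨h1, h2⟩ := him w hw
    rcases le_total 0 lam with h | h
    · exact (min_le_left _ _).trans (Real.rpow_le_rpow (by positivity) h1.le h)
    · exact (min_le_right _ _).trans
        (Real.rpow_le_rpow_of_nonpos (by linarith) h2.le h)
  set B := Metric.ball z₀ (y / 2) with hB
  have hBm : MeasurableSet B := Metric.isOpen_ball.measurableSet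
  have hmeasle : volume.restrict B ≤ (ENNReal.ofReal δ)⁻¹ • vHat lam := by
    have hδ0 : ENNReal.ofReal δ ≠ 0 := by simpa using hδ
    refine Measure.le_iff.2 fun s hs => ?_
    rw [Measure.smul_apply, smul_eq_mul, ← ENNReal.div_eq_inv_mul,
      ENNReal.le_div_iff_mul_le (Or.inl hδ0) (Or.inl ENNReal.ofReal_ne_top),
      Measure.restrict_apply hs, vHat, withDensity_apply _ hs, Measure.restrict_restrict hs,
      mul_comm, ← setLIntegral_const]
    calc _ ≤ ∫⁻ z in s ∩ B, ENNReal.ofReal (cConst lam / 4 * z.im ^ lam) :=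
          setLIntegral_mono' (hs.inter hBm) fun z hz => ENNReal.ofReal_le_ofReal (hδle z hz.2)
      _ ≤ _ := lintegral_mono_set (inter_subset_inter_right _ hball)
  set K := ENNReal.ofReal (y / 4 / 2) * ENNReal.ofReal (y / 4 / 2) *
    ENNReal.ofReal (2 * Real.pi) with hK
  have hK0 : K ≠ 0 := by
    have : 0 < y / 4 / 2 := by positivity
    simp [hK, this, Real.pi_pos]
  have hKt : K ≠ ∞ := by
    exact ENNReal.mul_ne_top (ENNReal.mul_ne_top ENNReal.ofReal_ne_top ENNReal.ofReal_ne_top)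
      ENNReal.ofReal_ne_top
  refine ⟨y / 4, by positivity, K⁻¹ * (((ENNReal.ofReal δ)⁻¹) ^ (1 / 2 : ℝ) *
    volume B ^ (1 / 2 : ℝ)), ?_, (Metric.ball_subset_ball (by linarith)).trans hball, ?_⟩
  · refine ENNReal.mul_ne_top (ENNReal.inv_ne_top.2 hK0) (ENNReal.mul_ne_top ?_ ?_)
    · exact ENNReal.rpow_ne_top_of_nonneg (by norm_num) (ENNReal.inv_ne_top.2 (by simpa using hδ))
    · exact ENNReal.rpow_ne_top_of_nonneg (by norm_num) measure_ball_lt_top.ne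
  intro g hg w hw
  have hsub : Metric.ball w (y / 4) ⊆ B := by
    refine Metric.ball_subset_ball' ?_
    have := Metric.mem_ball.1 hw
    linarith
  have hGm : Measurable (H.indicator g) := by
    rw [← piecewise_eq_indicator]
    exact hg.continuousOn.measurable_piecewise continuousOn_const hm
  have hwH : w ∈ H := hball (hsub (Metric.mem_ball_self (by positivity)))
  have hGeq : EqOn (H.indicator g) g H := fun z hz => indicator_of_mem hz _
  have h1 := enorm_le_ball hGm (w := w) (r := y / 4) (by positivity)
    ((hg.congr hGeq).mono (hsub.trans hball))
  rw [hGeq hwH, ← hK] at h1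
  have h2 : ∫⁻ z in Metric.ball w (y / 4), ‖H.indicator g z‖ₑ ≤
      eLpNorm (H.indicator g) 1 (volume.restrict B) := by
    rw [eLpNorm_one_eq_lintegral_enorm]
    exact lintegral_mono_set hsub
  have h3 : eLpNorm (H.indicator g) 1 (volume.restrict B) ≤
      eLpNorm (H.indicator g) 2 (volume.restrict B) * volume B ^ (1 / 2 : ℝ) := by
    refine (eLpNorm_le_eLpNorm_mul_rpow_measure_univ (p := 1) (q := 2) (by norm_num)
      hGm.aestronglyMeasurable).trans (le_of_eq ?_)
    rw [Measure.restrict_apply_univ]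
    norm_num
  have h4 : eLpNorm (H.indicator g) 2 (volume.restrict B) ≤
      ((ENNReal.ofReal δ)⁻¹) ^ (1 / 2 : ℝ) * eLpNorm g 2 (vHat lam) := by
    refine (eLpNorm_mono_measure _ hmeasle).trans (le_of_eq ?_)
    rw [eLpNorm_smul_measure_of_ne_top (by norm_num), smul_eq_mul]
    congr 1
    · norm_num
    · refine eLpNorm_congr_ae ((withDensity_absolutelyContinuous _ _).ae_le ?_)
      exact (ae_restrict_mem hm).mono fun z hz => hGeq hz
  calc ‖g w‖ₑ = K⁻¹ * (K * ‖g w‖ₑ) := by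
        rw [← mul_assoc, ENNReal.inv_mul_cancel hK0 hKt, one_mul]
    _ ≤ K⁻¹ * ((((ENNReal.ofReal δ)⁻¹) ^ (1 / 2 : ℝ) * eLpNorm g 2 (vHat lam)) *
        volume B ^ (1 / 2 : ℝ)) := by
        exact mul_le_mul_right ((h1.trans h2).trans (h3.trans (mul_le_mul_left h4 _))) _
    _ = _ := by ring

/-- The weighted Bergman space `𝒜²_λ(ℍ)`: the classes in `L²(ℍ, v̂_λ)` that have a representative
holomorphic on the upper half-plane. -/
def bergman (lam : ℝ) : Submodule ℂ (Lp ℂ 2 (vHat lam)) where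
  carrier := {f | ∃ g : ℂ → ℂ, DifferentiableOn ℂ g H ∧ f =ᵐ[vHat lam] g}
  zero_mem' := ⟨0, differentiableOn_const 0, Lp.coeFn_zero _ _ _⟩
  add_mem' := by
    rintro f₁ f₂ ⟨g₁, h₁, e₁⟩ ⟨g₂, h₂, e₂⟩
    exact ⟨g₁ + g₂, h₁.add h₂, (Lp.coeFn_add _ _).trans (e₁.add e₂)⟩
  smul_mem' := by
    rintro c f ⟨g, h, e⟩
    exact ⟨c • g, h.const_smul c, (Lp.coeFn_smul _ _).trans (e.const_smul c)⟩

lemma isClosed_bergman {lam : ℝ} (hlam : -1 < lam) :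
    IsClosed (bergman lam : Set (Lp ℂ 2 (vHat lam))) := by
  have hopen := UpperHalfPlane.isOpen_upperHalfPlaneSet
  refine IsSeqClosed.isClosed fun f f₀ hf hlim => ?_
  choose g hg hfg using hf
  have hcau := hlim.cauchySeq
  have hE : ∀ m n, eLpNorm (g m - g n) 2 (vHat lam) = ENNReal.ofReal (dist (f m) (f n)) := by
    intro m n
    rw [← edist_dist, Lp.edist_def]
    exact eLpNorm_congr_ae ((hfg m).symm.sub (hfg n).symm)
  -- local uniform Cauchy property
  have hU : ∀ z₀ ∈ H, ∃ r > 0, Metric.ball z₀ r ⊆ H ∧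
      UniformCauchySeqOn g atTop (Metric.ball z₀ r) := by
    intro z₀ hz₀
    obtain ⟨r, hr, C, hC, hsub, hb⟩ := enorm_le_eLpNorm hlam hz₀
    refine ⟨r, hr, hsub, Metric.uniformCauchySeqOn_iff.2 fun ε hε => ?_⟩
    obtain ⟨N, hN⟩ := Metric.cauchySeq_iff.1 hcau (ε / (C.toReal + 1)) (by positivity)
    refine ⟨N, fun m hm n hn w hw => ?_⟩
    have h1 := hb (g m - g n) ((hg m).sub (hg n)) w hw
    rw [hE, ← ENNReal.ofReal_toReal hC, ← ENNReal.ofReal_mul ENNReal.toReal_nonneg,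
      ← ofReal_norm, ENNReal.ofReal_le_ofReal_iff (by positivity)] at h1
    rw [dist_eq_norm]
    have h2 := hN m hm n hn
    calc _ ≤ C.toReal * dist (f m) (f n) := h1
      _ ≤ (C.toReal + 1) * dist (f m) (f n) := by gcongr; linarith
      _ < (C.toReal + 1) * (ε / (C.toReal + 1)) := by gcongr
      _ = ε := by field_simp
  have hex : ∀ z, ∃ l, z ∈ H → Tendsto (fun n => g n z) atTop (𝓝 l) := by
    intro z
    by_cases hz : z ∈ H
    · obtain ⟨r, hr, -, hu⟩ := hU z hz
      obtain ⟨l, hl⟩ := cauchySeq_tendsto_of_complete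
        (hu.cauchySeq (Metric.mem_ball_self hr))
      exact ⟨l, fun _ => hl⟩
    · exact ⟨0, fun h => absurd h hz⟩
  choose g₀ hg₀ using hex
  have hloc : TendstoLocallyUniformlyOn g g₀ atTop H := by
    refine tendstoLocallyUniformlyOn_of_forall_exists_nhds fun z hz => ?_
    obtain ⟨r, hr, hsub, hu⟩ := hU z hz
    exact ⟨Metric.ball z r, mem_nhdsWithin_of_mem_nhds (Metric.ball_mem_nhds z hr),
      hu.tendstoUniformlyOn_of_tendsto fun w hw => hg₀ w (hsub hw)⟩
  refine ⟨g₀, hloc.differentiableOn (Eventually.of_forall hg) hopen, ?_⟩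
  have hmeas : TendstoInMeasure (vHat lam) (fun n => (f n : ℂ → ℂ)) atTop f₀ :=
    tendstoInMeasure_of_tendsto_Lp hlim
  obtain ⟨ns, hns, hae⟩ := hmeas.exists_seq_tendsto_ae
  have hmem : ∀ᵐ z ∂(vHat lam), z ∈ H :=
    (withDensity_absolutelyContinuous _ _).ae_le (ae_restrict_mem hopen.measurableSet)
  filter_upwards [hae, hmem, ae_all_iff.2 hfg] with z h1 h2 h3
  refine tendsto_nhds_unique h1 ?_
  simp only [h3]
  exact (hg₀ z h2).comp hns.tendsto_atTop

instance (lam : ℝ) [hlam : Fact (-1 < lam)] : CompleteSpace (bergman lam) :=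
  (isClosed_bergman hlam.out).completeSpace_coe

lemma vHat_absolutelyContinuous (lam : ℝ) : vHat lam ≪ volume.restrict H :=
  withDensity_absolutelyContinuous _ _

lemma memLp_vHat {a : ℂ → ℂ} (ha : MemLp a ∞ (volume.restrict H)) (lam : ℝ) :
    MemLp a ∞ (vHat lam) :=
  ⟨ha.1.mono_ac (vHat_absolutelyContinuous lam), by
    rw [eLpNorm_exponent_top]
    exact (eLpNormEssSup_mono_measure a (vHat_absolutelyContinuous lam)).trans_lt
      (by simpa only [eLpNorm_exponent_top] using ha.2)⟩

/-- The Toeplitz operator `T_a = B ∘ M_a` on the Bergman space, where `B` is the orthogonal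
projection of `L²(ℍ, v̂_λ)` onto the Bergman space and `a ∈ L^∞(ℍ)`. -/
def toeplitz (lam : ℝ) [Fact (-1 < lam)] (a : ℂ → ℂ) (ha : MemLp a ∞ (volume.restrict H)) :
    bergman lam →L[ℂ] bergman lam :=
  (bergman lam).orthogonalProjectionOnto ∘L
    mulOp a (memLp_vHat ha lam) ∘L (bergman lam).subtypeL

open FourierTransform SchwartzMap in
/-- Plancherel's theorem for the Fourier integral of a function in `L¹ ∩ L²`. -/
lemma lintegral_fourier_sq {f : ℝ → ℂ} (h1 : Integrable f) (h2 : MemLp f 2) :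
    ∫⁻ ξ, ‖𝓕 f ξ‖ₑ ^ 2 = ∫⁻ x, ‖f x‖ₑ ^ 2 := by
  set F2 : Lp ℂ 2 (volume : Measure ℝ) := 𝓕 (h2.toLp f) with hF2
  have hcont : Continuous (𝓕 f) := VectorFourier.fourierIntegral_continuous
    Real.continuous_fourierChar (by exact continuous_inner) h1
  have hae : ∀ᵐ x, (F2 : ℝ → ℂ) x = 𝓕 f x := by
    refine ae_eq_of_integral_contDiff_smul_eq ((Lp.memLp F2).locallyIntegrable (by norm_num))
      hcont.locallyIntegrable fun g g_smooth g_cpt => ?_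
    have hg₁ : HasCompactSupport (Complex.ofRealCLM ∘ g) := g_cpt.comp_left rfl
    have hg₂ : ContDiff ℝ (⊤ : ℕ∞) (Complex.ofRealCLM ∘ g) := by fun_prop
    set G : 𝓢(ℝ, ℂ) := hg₁.toSchwartzMap hg₂ with hG
    have e1 : ∫ x, g x • (F2 : ℝ → ℂ) x = Lp.toTemperedDistribution F2 G := by
      rw [Lp.toTemperedDistribution_apply]; simp [hG]
    rw [e1, hF2, ← Lp.fourier_toTemperedDistribution_eq, TemperedDistribution.fourier_apply,
      Lp.toTemperedDistribution_apply]
    have e2 : ∫ x, (𝓕 G) x • (h2.toLp f : ℝ → ℂ) x = ∫ x, 𝓕 (G : ℝ → ℂ) x • f x := by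
      refine integral_congr_ae ?_
      filter_upwards [h2.coeFn_toLp] with x hx
      rw [hx, SchwartzMap.fourier_coe]
    rw [e2]
    have := VectorFourier.integral_fourierIntegral_smul_eq_flip (L := innerₗ ℝ)
      Real.continuous_fourierChar (by exact continuous_inner) (G.integrable (μ := volume)) h1
    rw [flip_innerₗ] at this
    refine this.trans (integral_congr_ae (Eventually.of_forall fun x => ?_))
    change Complex.ofRealCLM (g x) • 𝓕 f x = g x • 𝓕 f x
    simp
  have hn : ‖F2‖ = ‖h2.toLp f‖ := Lp.norm_fourier_eq _
  rw [Lp.norm_def, Lp.norm_def, ENNReal.toReal_eq_toReal_iff' (Lp.eLpNorm_ne_top _)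
    (Lp.eLpNorm_ne_top _), eLpNorm_congr_ae hae, eLpNorm_congr_ae h2.coeFn_toLp,
    eLpNorm_eq_lintegral_rpow_enorm_toReal (by norm_num) (by norm_num),
    eLpNorm_eq_lintegral_rpow_enorm_toReal (by norm_num) (by norm_num)] at hn
  simp only [ENNReal.toReal_ofNat, ENNReal.rpow_ofNat] at hn
  exact (ENNReal.rpow_left_injective (by norm_num)) hn

lemma exp_neg_image : (fun u : ℝ => Real.exp (-u)) '' univ = Ioi 0 := by
  ext x
  simp only [image_univ, mem_range, mem_Ioi]
  exact ⟨fun ⟨u, hu⟩ => hu ▸ Real.exp_pos _,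
    fun hx => ⟨-Real.log x, by rw [neg_neg, Real.exp_log hx]⟩⟩

/-- Plancherel's theorem for the Mellin transform. -/
lemma lintegral_mellin_sq {lam : ℝ} {f : ℝ → ℂ}
    (h1 : IntegrableOn (fun s => ((s ^ (lam / 2) : ℝ) : ℂ) * f s) (Ioi 0))
    (h2 : ∫⁻ s in Ioi 0, ENNReal.ofReal (s ^ (1 + lam)) * ‖f s‖ₑ ^ 2 ≠ ∞) :
    ∫⁻ ξ : ℝ, ‖((Real.sqrt (2 * Real.pi))⁻¹ : ℂ) * mellin f ((lam : ℂ) / 2 + 1 - I * ξ)‖ₑ ^ 2 =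
      ∫⁻ s in Ioi 0, ENNReal.ofReal (s ^ (1 + lam)) * ‖f s‖ₑ ^ 2 := by
  have hder : ∀ x ∈ (univ : Set ℝ),
      HasDerivWithinAt (fun u : ℝ => Real.exp (-u)) (-Real.exp (-x)) univ x := fun x _ => by
    have := (hasDerivAt_neg x).exp.hasDerivWithinAt (s := univ)
    rwa [mul_neg_one] at this
  have hinj : InjOn (fun u : ℝ => Real.exp (-u)) univ := fun a _ b _ hab => by
    simpa using hab
  set g : ℝ → ℂ := fun u => (Real.exp (-(lam / 2 + 1) * u)) • f (Real.exp (-u)) with hg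
  have hgi : Integrable g := by
    rw [← exp_neg_image, integrableOn_image_iff_integrableOn_abs_deriv_smul MeasurableSet.univ
      hder hinj, integrableOn_univ] at h1
    refine h1.congr (Eventually.of_forall fun u => ?_)
    simp only [hg, abs_neg, abs_of_pos (Real.exp_pos _), Complex.real_smul]
    rw [← mul_assoc, ← Complex.ofReal_mul, ← Real.exp_mul, ← Real.exp_add]
    congr 3; ring
  have hgl : ∫⁻ u, ‖g u‖ₑ ^ 2 = ∫⁻ s in Ioi 0, ENNReal.ofReal (s ^ (1 + lam)) * ‖f s‖ₑ ^ 2 := by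
    rw [← exp_neg_image, lintegral_image_eq_lintegral_abs_deriv_mul MeasurableSet.univ hder hinj,
      setLIntegral_univ]
    refine lintegral_congr fun u => ?_
    simp only [hg, abs_neg, abs_of_pos (Real.exp_pos _)]
    rw [enorm_smul, mul_pow, ← mul_assoc, ← ENNReal.ofReal_mul (Real.exp_pos _).le,
      Real.enorm_eq_ofReal (Real.exp_pos _).le, ← ENNReal.ofReal_pow (Real.exp_pos _).le,
      ← Real.exp_nat_mul, ← Real.exp_mul, ← Real.exp_add]
    congr 3; push_cast; ring
  have hgm : MemLp g 2 := by
    refine ⟨hgi.1, ?_⟩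
    rw [eLpNorm_eq_lintegral_rpow_enorm_toReal (by norm_num) (by norm_num)]
    simp only [ENNReal.toReal_ofNat, ENNReal.rpow_ofNat, hgl]
    exact ENNReal.rpow_lt_top_of_nonneg (by norm_num) h2
  rw [← hgl, ← lintegral_fourier_sq hgi hgm]
  have hmf : ∀ ξ : ℝ, mellin f ((lam : ℂ) / 2 + 1 - I * ξ) =
      FourierTransform.fourier g (-(2 * Real.pi)⁻¹ * ξ) := fun ξ => by
    rw [mellin_eq_fourier]
    have e1 : ((lam : ℂ) / 2 + 1 - I * ξ).re = lam / 2 + 1 := by simp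
    have e2 : ((lam : ℂ) / 2 + 1 - I * ξ).im = -ξ := by simp
    rw [e1, e2, show -ξ / (2 * Real.pi) = -(2 * Real.pi)⁻¹ * ξ by ring]
  simp only [hmf, enorm_mul, mul_pow]
  have hpi : 0 < 2 * Real.pi := by positivity
  have hc0 : -(2 * Real.pi)⁻¹ ≠ 0 := by simp [Real.pi_ne_zero]
  have key := lintegral_image_eq_lintegral_abs_deriv_mul (s := univ)
      (f := fun x : ℝ => -(2 * Real.pi)⁻¹ * x) (f' := fun _ => -(2 * Real.pi)⁻¹)
      MeasurableSet.univ
      (fun x _ => ((hasDerivAt_id x).const_mul _ |>.congr_deriv (by simp)).hasDerivWithinAt)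
      (fun a _ b _ hab => mul_left_cancel₀ hc0 hab)
      (fun x => ‖FourierTransform.fourier g x‖ₑ ^ 2)
  rw [image_univ, (mul_left_surjective₀ hc0).range_eq, setLIntegral_univ,
    setLIntegral_univ] at key
  rw [key]
  refine lintegral_congr fun ξ => ?_
  congr 1
  rw [abs_neg, abs_of_pos (by positivity), ← ofReal_norm, ← ENNReal.ofReal_pow (norm_nonneg _)]
  congr 1
  rw [norm_inv, Complex.norm_real, Real.norm_eq_abs, inv_pow, sq_abs, Real.sq_sqrt hpi.le]

/-- The Mellin transform in the variable `s`, with `h` as a parameter: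
`(2π) ^ (-1/2) ∫₀^∞ φ(s, h) s ^ (λ/2 - iξ) ds` as a function of `(ξ, h)`. -/
def partialMellin (lam : ℝ) (φ : ℝ × ℝ → ℂ) (p : ℝ × ℝ) : ℂ :=
  ((Real.sqrt (2 * Real.pi))⁻¹ : ℂ) *
    mellin (fun s => φ (s, p.2)) ((lam : ℂ) / 2 + 1 - I * (p.1 : ℂ))

/-- The measure `ds dh` on `(0, ∞) × ℝ`. -/
def baseMeasure : Measure (ℝ × ℝ) := (volume.restrict (Ioi (0 : ℝ))).prod volume

lemma base_ac {lam : ℝ} (hlam : -1 < lam) : baseMeasure ≪ nuHat lam := by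
  refine Measure.AbsolutelyContinuous.prod ?_ ?_
  · refine withDensity_absolutelyContinuous' (by fun_prop) ?_
    refine (ae_restrict_mem measurableSet_Ioi).mono fun s hs => ?_
    have : 0 < s ^ (1 + lam) := Real.rpow_pos_of_pos hs _
    simpa using this
  · refine Measure.absolutelyContinuous_smul ?_
    have : 0 < cConst lam / 4 := div_pos (cConst_pos hlam) (by norm_num)
    simpa using this

lemma rho_ac (lam : ℝ) : rho lam ≪ volume.prod volume :=
  Measure.AbsolutelyContinuous.prod (Measure.AbsolutelyContinuous.refl _)
    (Measure.smul_absolutelyContinuous)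

lemma lintegral_nuHat (lam : ℝ) {g : ℝ × ℝ → ℝ≥0∞} (hg : Measurable g) :
    ∫⁻ p, g p ∂(nuHat lam) = ENNReal.ofReal (cConst lam / 4) *
      ∫⁻ p, ENNReal.ofReal (p.1 ^ (1 + lam)) * g p ∂baseMeasure := by
  have hm : Measurable fun p : ℝ × ℝ => ENNReal.ofReal (p.1 ^ (1 + lam)) * g p := by fun_prop
  rw [nuHat, lintegral_prod_symm _ hg.aemeasurable, lintegral_momentMeasure, baseMeasure,
    lintegral_prod_symm _ hm.aemeasurable]
  simp only [lintegral_radialMeasure]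

/-- The classes `φ` for which the Mellin integrals converge absolutely: those with
`s ^ (λ/2) φ(s, h)` integrable with respect to `ds dh`. -/
def mellinDomain (lam : ℝ) [hlam : Fact (-1 < lam)] : Submodule ℂ (Lp ℂ 2 (nuHat lam)) where
  carrier := {φ | Integrable (fun p => ((p.1 ^ (lam / 2) : ℝ) : ℂ) * φ p) baseMeasure}
  zero_mem' := by
    refine (integrable_zero _ _ _).congr ?_
    filter_upwards [(base_ac hlam.out).ae_le (Lp.coeFn_zero ℂ 2 (nuHat lam))] with p hp
    rw [hp]; simp
  add_mem' := by
    intro f g hf hg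
    refine (Integrable.add hf hg).congr ?_
    filter_upwards [(base_ac hlam.out).ae_le (Lp.coeFn_add f g)] with p hp
    rw [hp]; simp [mul_add]
  smul_mem' := by
    intro c f hf
    refine (Integrable.const_mul hf c).congr ?_
    filter_upwards [(base_ac hlam.out).ae_le (Lp.coeFn_smul c f)] with p hp
    rw [hp]; simp [mul_left_comm]

lemma stronglyMeasurable_partialMellin (lam : ℝ) {φ : ℝ × ℝ → ℂ} (hφ : StronglyMeasurable φ) :
    StronglyMeasurable (partialMellin lam φ) := by
  unfold partialMellin mellin
  refine StronglyMeasurable.const_mul ?_ _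
  refine StronglyMeasurable.integral_prod_right'
    (f := fun q : (ℝ × ℝ) × ℝ => (q.2 : ℂ) ^ ((lam : ℂ) / 2 + 1 - I * (q.1.1 : ℂ) - 1) •
      φ (q.2, q.1.2)) ?_
  have := hφ.measurable
  exact Measurable.stronglyMeasurable (by fun_prop)

lemma norm_cpow_aux (lam ξ : ℝ) {s : ℝ} (hs : 0 < s) :
    ‖(s : ℂ) ^ ((lam : ℂ) / 2 + 1 - I * (ξ : ℂ) - 1)‖ = s ^ (lam / 2) := by
  rw [Complex.norm_cpow_eq_rpow_re_of_pos hs]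
  congr 1
  simp

lemma ae_slice {lam : ℝ} [hlam : Fact (-1 < lam)] {φ : Lp ℂ 2 (nuHat lam)}
    (hφ : φ ∈ mellinDomain lam) : ∀ᵐ h : ℝ,
      IntegrableOn (fun s => ((s ^ (lam / 2) : ℝ) : ℂ) * φ (s, h)) (Ioi 0) ∧
      ∀ ξ : ℝ, MellinConvergent (fun s => φ (s, h)) ((lam : ℂ) / 2 + 1 - I * (ξ : ℂ)) := by
  have h1 := Integrable.prod_left_ae (μ := volume.restrict (Ioi (0 : ℝ))) (ν := volume) hφ
  have hm := (Lp.stronglyMeasurable φ).measurable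
  filter_upwards [h1] with h hh
  refine ⟨hh, fun ξ => ?_⟩
  refine Integrable.mono hh (Measurable.aestronglyMeasurable (by fun_prop)) ?_
  refine (ae_restrict_mem measurableSet_Ioi).mono fun s hs => ?_
  rw [norm_smul, norm_cpow_aux lam ξ hs, norm_mul, Complex.norm_real,
    Real.norm_of_nonneg (Real.rpow_nonneg (le_of_lt hs) _)]

lemma ae_rho_of_ae_snd (lam : ℝ) {P : ℝ × ℝ → Prop} (h : ∀ᵐ x : ℝ, ∀ ξ : ℝ, P (ξ, x)) :
    ∀ᵐ p ∂(rho lam), P p := by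
  refine (rho_ac lam).ae_le ?_
  have := (Measure.quasiMeasurePreserving_snd (μ := (volume : Measure ℝ))
    (ν := (volume : Measure ℝ))).ae h
  exact this.mono fun p hp => hp p.1

lemma ae_base_swap {P : ℝ × ℝ → Prop} (h : ∀ᵐ p ∂baseMeasure, P p) :
    ∀ᵐ x : ℝ, ∀ᵐ s ∂(volume.restrict (Ioi (0 : ℝ))), P (s, x) :=
  Measure.ae_ae_of_ae_prod ((Measure.measurePreserving_swap (μ := (volume : Measure ℝ))
    (ν := volume.restrict (Ioi (0 : ℝ)))).quasiMeasurePreserving.ae h)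

lemma partialMellin_congr {lam : ℝ} (hlam : -1 < lam) {φ ψ : ℝ × ℝ → ℂ}
    (h : φ =ᵐ[nuHat lam] ψ) : partialMellin lam φ =ᵐ[rho lam] partialMellin lam ψ := by
  refine ae_rho_of_ae_snd lam ?_
  filter_upwards [ae_base_swap ((base_ac hlam).ae_le h)] with x hx ξ
  unfold partialMellin mellin
  congr 1
  refine integral_congr_ae ?_
  filter_upwards [hx] with s hs
  simp only [hs]

lemma partialMellin_add {lam : ℝ} [Fact (-1 < lam)] {φ ψ : Lp ℂ 2 (nuHat lam)}
    (hφ : φ ∈ mellinDomain lam) (hψ : ψ ∈ mellinDomain lam) :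
    partialMellin lam (⇑φ + ⇑ψ) =ᵐ[rho lam] partialMellin lam φ + partialMellin lam ψ := by
  refine ae_rho_of_ae_snd lam ?_
  filter_upwards [ae_slice hφ, ae_slice hψ] with x h1 h2 ξ
  simp only [partialMellin, Pi.add_apply]
  rw [← mul_add, ← (hasMellin_add (h1.2 ξ) (h2.2 ξ)).2]

lemma partialMellin_smul (lam : ℝ) (c : ℂ) (φ : ℝ × ℝ → ℂ) :
    partialMellin lam (c • φ) = c • partialMellin lam φ := by
  ext p
  simp only [partialMellin, Pi.smul_apply, smul_eq_mul]
  have := mellin_const_smul (fun s => φ (s, p.2)) ((lam : ℂ) / 2 + 1 - I * (p.1 : ℂ)) c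
  simp only [smul_eq_mul] at this
  rw [this]; ring

lemma lintegral_Lp_ne_top {α : Type*} [MeasurableSpace α] {μ : Measure α} (φ : Lp ℂ 2 μ) :
    ∫⁻ p, ‖φ p‖ₑ ^ 2 ∂μ ≠ ∞ := by
  have h := Lp.eLpNorm_ne_top φ
  rw [eLpNorm_eq_lintegral_rpow_enorm_toReal (by norm_num) (by norm_num)] at h
  simp only [ENNReal.toReal_ofNat, ENNReal.rpow_ofNat] at h
  intro ht
  rw [ht] at h
  simp at h

lemma lintegral_base_ne_top {lam : ℝ} (hlam : -1 < lam) (φ : Lp ℂ 2 (nuHat lam)) :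
    ∫⁻ p, ENNReal.ofReal (p.1 ^ (1 + lam)) * ‖φ p‖ₑ ^ 2 ∂baseMeasure ≠ ∞ := by
  have hm := (Lp.stronglyMeasurable φ).measurable
  have h := lintegral_Lp_ne_top φ
  rw [lintegral_nuHat lam (by fun_prop)] at h
  intro ht
  have hc : 0 < cConst lam / 4 := div_pos (cConst_pos hlam) (by norm_num)
  rw [ht, ENNReal.mul_top (by simpa using hc)] at h
  exact h rfl

lemma lintegral_partialMellin_sq {lam : ℝ} [hlam : Fact (-1 < lam)] {φ : Lp ℂ 2 (nuHat lam)}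
    (hφ : φ ∈ mellinDomain lam) :
    ∫⁻ p, ‖partialMellin lam φ p‖ₑ ^ 2 ∂(rho lam) = ∫⁻ p, ‖φ p‖ₑ ^ 2 ∂(nuHat lam) := by
  have hm := (Lp.stronglyMeasurable φ).measurable
  have hM := (stronglyMeasurable_partialMellin lam (Lp.stronglyMeasurable φ)).measurable
  have hm' : Measurable fun p : ℝ × ℝ => ENNReal.ofReal (p.1 ^ (1 + lam)) * ‖φ p‖ₑ ^ 2 := by
    fun_prop
  have hM' : Measurable fun p => ‖partialMellin lam φ p‖ₑ ^ 2 := hM.enorm.pow_const 2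
  rw [lintegral_nuHat lam (hm.enorm.pow_const 2), rho, lintegral_prod_symm _ hM'.aemeasurable,
    lintegral_momentMeasure, baseMeasure, lintegral_prod_symm _ hm'.aemeasurable]
  congr 1
  refine lintegral_congr_ae ?_
  have hfin := lintegral_base_ne_top hlam.out φ
  rw [baseMeasure, lintegral_prod_symm _ hm'.aemeasurable] at hfin
  filter_upwards [ae_slice hφ, ae_lt_top hm'.lintegral_prod_left' hfin] with x h1 h2
  have h3 := lintegral_mellin_sq h1.1 h2.ne
  simp only [partialMellin]
  exact h3

/-- The partial Mellin transform on the functions with absolutely convergent Mellin integrals. -/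
def mellinCore (lam : ℝ) [hlam : Fact (-1 < lam)] :
    mellinDomain lam →ₗᵢ[ℂ] Lp ℂ 2 (rho lam) :=
  have hn : ∀ φ : mellinDomain lam,
      eLpNorm (partialMellin lam φ) 2 (rho lam) = eLpNorm (φ : Lp ℂ 2 (nuHat lam)) 2 (nuHat lam) :=
    fun φ => eLpNorm_two_eq_of_lintegral (lintegral_partialMellin_sq φ.2)
  have hmem : ∀ φ : mellinDomain lam, MemLp (partialMellin lam φ) 2 (rho lam) := fun φ =>
    ⟨(stronglyMeasurable_partialMellin lam (Lp.stronglyMeasurable φ.1)).aestronglyMeasurable, by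
      rw [hn φ]; exact Lp.eLpNorm_lt_top φ.1⟩
  { toFun := fun φ => (hmem φ).toLp (partialMellin lam φ)
    map_add' := fun φ ψ => by
      rw [← MemLp.toLp_add, MemLp.toLp_eq_toLp_iff]
      exact (partialMellin_congr hlam.out (Lp.coeFn_add φ.1 ψ.1)).trans
        (partialMellin_add φ.2 ψ.2)
    map_smul' := fun c φ => by
      rw [RingHom.id_apply, ← MemLp.toLp_const_smul, MemLp.toLp_eq_toLp_iff,
        ← partialMellin_smul]
      exact partialMellin_congr hlam.out (Lp.coeFn_smul c φ.1)
    norm_map' := fun φ => by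
      simp only [LinearMap.coe_mk, AddHom.coe_mk]
      rw [Lp.norm_toLp, hn φ, Submodule.coe_norm, Lp.norm_def] }

lemma coeFn_mellinCore (lam : ℝ) [hlam : Fact (-1 < lam)] (φ : mellinDomain lam) :
    mellinCore lam φ =ᵐ[rho lam] partialMellin lam φ := by
  have h : MemLp (partialMellin lam φ) 2 (rho lam) :=
    ⟨(stronglyMeasurable_partialMellin lam (Lp.stronglyMeasurable φ.1)).aestronglyMeasurable, by
      rw [eLpNorm_two_eq_of_lintegral (lintegral_partialMellin_sq φ.2)]
      exact Lp.eLpNorm_lt_top φ.1⟩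
  exact h.coeFn_toLp

lemma indicator_mem_mellinDomain {lam : ℝ} [hlam : Fact (-1 < lam)] (φ : Lp ℂ 2 (nuHat lam))
    {a b c : ℝ} (ha : 0 < a) :
    ((Lp.memLp φ).indicator (s := Icc a b ×ˢ Icc (-c) c)
      (measurableSet_Icc.prod measurableSet_Icc)).toLp _ ∈ mellinDomain lam := by
  set K : Set (ℝ × ℝ) := Icc a b ×ˢ Icc (-c) c with hK
  have hKm : MeasurableSet K := measurableSet_Icc.prod measurableSet_Icc
  have hm := (Lp.stronglyMeasurable φ).measurable
  have hKfin : baseMeasure K ≠ ∞ := by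
    rw [baseMeasure, hK, Measure.prod_prod]
    exact ENNReal.mul_ne_top ((Measure.restrict_apply_le _ _).trans_lt
      (by simp [Real.volume_Icc])).ne (by simp [Real.volume_Icc])
  have h1 : Integrable (K.indicator fun _ => a⁻¹) baseMeasure :=
    (integrable_indicator_iff hKm).2 (integrableOn_const hKfin)
  have h2 : Integrable (fun p : ℝ × ℝ => |p.1 ^ (1 + lam)| * ‖φ p‖ ^ 2) baseMeasure := by
    refine ⟨Measurable.aestronglyMeasurable (by fun_prop), ?_⟩
    have h := lintegral_base_ne_top hlam.out φ
    refine lt_of_le_of_lt (le_of_eq ?_) h.lt_top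
    have hpos : ∀ᵐ p ∂baseMeasure, 0 < p.1 :=
      (Measure.quasiMeasurePreserving_fst (μ := volume.restrict (Ioi (0 : ℝ)))
        (ν := (volume : Measure ℝ))).ae (ae_restrict_mem measurableSet_Ioi)
    refine lintegral_congr_ae (hpos.mono fun p hp => ?_)
    have : 0 < p.1 ^ (1 + lam) := Real.rpow_pos_of_pos hp _
    simp only
    rw [enorm_mul, Real.enorm_eq_ofReal (abs_nonneg _), abs_of_pos this, enorm_pow, enorm_norm]
  refine ((h1.add h2).mono' (g := _) (f := fun p => ((p.1 ^ (lam / 2) : ℝ) : ℂ) *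
    K.indicator φ p) ?_ ?_).congr ?_
  · have := hm.indicator hKm
    exact Measurable.aestronglyMeasurable (by fun_prop)
  · refine Eventually.of_forall fun p => ?_
    simp only [Pi.add_apply]
    by_cases hp : p ∈ K
    · rw [indicator_of_mem hp, indicator_of_mem hp]
      have hap : a ≤ p.1 := hp.1.1
      have hp0 : 0 < p.1 := ha.trans_le hap
      rw [norm_mul, Complex.norm_real, Real.norm_eq_abs,
        abs_of_pos (Real.rpow_pos_of_pos hp0 _), abs_of_pos (Real.rpow_pos_of_pos hp0 _)]
      have e1 : p.1 ^ (1 + lam) = p.1 * (p.1 ^ (lam / 2)) ^ 2 := by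
        rw [← Real.rpow_mul_natCast hp0.le, Real.rpow_add hp0, Real.rpow_one]
        congr 2; push_cast; ring
      have e2 : p.1⁻¹ ≤ a⁻¹ := by gcongr
      rw [e1]
      set t := p.1 ^ (lam / 2) * ‖φ p‖ with ht
      have e3 : p.1 * (p.1 ^ (lam / 2)) ^ 2 * ‖φ p‖ ^ 2 = p.1 * t ^ 2 := by rw [ht]; ring
      rw [e3]
      have e4 : t ≤ p.1⁻¹ + p.1 * t ^ 2 := by
        have : 0 ≤ p.1⁻¹ * ((p.1 * t - 1 / 2) ^ 2 + 3 / 4) := by positivity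
        have e5 : p.1⁻¹ * ((p.1 * t - 1 / 2) ^ 2 + 3 / 4) = p.1 * t ^ 2 - t + p.1⁻¹ := by
          field_simp; ring
        linarith
      linarith
    · rw [indicator_of_notMem hp, indicator_of_notMem hp]
      simp only [mul_zero, norm_zero, zero_add]
      positivity
  · filter_upwards [(base_ac hlam.out).ae_le (((Lp.memLp φ).indicator hKm).coeFn_toLp)] with p hp
    rw [hp]

lemma dense_mellinDomain (lam : ℝ) [hlam : Fact (-1 < lam)] :
    DenseRange (mellinDomain lam).subtypeL := by
  have hd : (mellinDomain lam).topologicalClosure = ⊤ := by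
    rw [Submodule.topologicalClosure_eq_top_iff, Submodule.eq_bot_iff]
    intro φ hφ
    rw [Submodule.mem_orthogonal] at hφ
    have hm := (Lp.stronglyMeasurable φ).measurable
    have key : ∀ n : ℕ, ∀ᵐ p ∂(nuHat lam),
        p ∈ Icc ((n + 1 : ℝ)⁻¹) (n + 1) ×ˢ Icc (-(n : ℝ)) n → φ p = 0 := by
      intro n
      set K : Set (ℝ × ℝ) := Icc ((n + 1 : ℝ)⁻¹) (n + 1) ×ˢ Icc (-(n : ℝ)) n with hK
      have hKm : MeasurableSet K := measurableSet_Icc.prod measurableSet_Icc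
      have h0 := hφ _ (indicator_mem_mellinDomain φ (a := (n + 1 : ℝ)⁻¹) (b := n + 1) (c := n)
        (by positivity))
      rw [L2.inner_def] at h0
      have h1 : ∫ p, ((K.indicator (fun p => ‖φ p‖ ^ 2) p : ℝ) : ℂ) ∂(nuHat lam) = 0 := by
        rw [← h0]
        refine integral_congr_ae ?_
        filter_upwards [((Lp.memLp φ).indicator hKm).coeFn_toLp] with p hp
        rw [hp]
        by_cases hpK : p ∈ K
        · simp only [indicator_of_mem hpK, RCLike.inner_apply]
          rw [Complex.mul_conj, Complex.normSq_eq_norm_sq]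
        · simp [indicator_of_notMem hpK]
      rw [integral_complex_ofReal, Complex.ofReal_eq_zero,
        integral_eq_zero_iff_of_nonneg (fun p => indicator_nonneg (fun _ _ => by positivity) p)
        ((Lp.memLp φ).integrable_norm_pow (by norm_num) |>.indicator hKm)] at h1
      filter_upwards [h1] with p hp hpK
      rw [indicator_of_mem hpK] at hp
      simpa using hp
    rw [Lp.eq_zero_iff_ae_eq_zero]
    have hpos : ∀ᵐ p ∂(nuHat lam), 0 < p.1 := by
      refine (Measure.quasiMeasurePreserving_fst (μ := radialMeasure lam)
        (ν := momentMeasure lam)).ae ?_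
      exact (withDensity_absolutelyContinuous _ _).ae_le (ae_restrict_mem measurableSet_Ioi)
    filter_upwards [ae_all_iff.2 key, hpos] with p hp hp0
    obtain ⟨n, hn⟩ := exists_nat_ge (max (max p.1 p.1⁻¹) |p.2|)
    have h1 : p.1 ≤ n := ((le_max_left _ _).trans (le_max_left _ _)).trans hn
    have h2 : p.1⁻¹ ≤ n := ((le_max_right _ _).trans (le_max_left _ _)).trans hn
    have h3 : |p.2| ≤ n := (le_max_right _ _).trans hn
    refine hp n ⟨⟨?_, by linarith⟩, abs_le.1 h3⟩
    exact inv_le_of_inv_le₀ hp0 (by linarith)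
  have := (Submodule.dense_iff_topologicalClosure_eq_top).2 hd
  simpa [DenseRange] using this

/-- `U₁ = ℳ ⊗ I`: the continuous extension to `L²` of the partial Mellin transform. -/
def U1 (lam : ℝ) [Fact (-1 < lam)] : Lp ℂ 2 (nuHat lam) →L[ℂ] Lp ℂ 2 (rho lam) :=
  (mellinCore lam).toContinuousLinearMap.extend (mellinDomain lam).subtypeL

/-- The extension `U₁` is given by the Mellin integral where that converges absolutely. -/
lemma coeFn_U1 (lam : ℝ) [Fact (-1 < lam)] (φ : Lp ℂ 2 (nuHat lam))
    (hφ : φ ∈ mellinDomain lam) : U1 lam φ =ᵐ[rho lam] partialMellin lam φ := by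
  have : U1 lam φ = mellinCore lam ⟨φ, hφ⟩ :=
    ContinuousLinearMap.extend_eq _ (dense_mellinDomain lam)
      (mellinDomain lam).subtypeₗᵢ.isometry.isUniformInducing ⟨φ, hφ⟩
  rw [this]
  exact coeFn_mellinCore lam ⟨φ, hφ⟩

/-- The Bargmann-type transform `R_λ = W_λ* ∘ U₂ ∘ U₁ ∘ U₀ : L²(ℍ, v̂_λ) → L²(ℝ)`. -/
def R (lam : ℝ) [Fact (-1 < lam)] : Lp ℂ 2 (vHat lam) →L[ℂ] Lp ℂ 2 (volume : Measure ℝ) :=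
  ContinuousLinearMap.adjoint (W lam).toContinuousLinearMap ∘L (U2 lam).toContinuousLinearMap ∘L
    U1 lam ∘L (U0 lam).toContinuousLinearMap

/-- `a` is a hyperbolic symbol: for every `s > 0`, `a(s z) = a(z)` for almost every `z` in the upper
half-plane. -/
def IsHyperbolicSymbol (a : ℂ → ℂ) : Prop :=
  ∀ s : ℝ, 0 < s → ∀ᵐ z ∂(volume.restrict H), a ((s : ℂ) * z) = a z

/-- The spectral function
`γ(ξ) = V(2ξ, -λ/2)⁻¹ ∫ exp (-2ξ arccot u) (1 + u²) ^ (-(λ/2 + 1)) f(u) du`. -/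
def gamma (f : ℝ → ℂ) (lam ξ : ℝ) : ℂ :=
  1 / (V (2 * ξ) (-lam / 2) : ℂ) *
    ∫ u : ℝ, ((Real.exp (-2 * ξ * arccot u) / (1 + u ^ 2) ^ (lam / 2 + 1) : ℝ) : ℂ) * f u

end HyperbolicToeplitz

end

open MeasureTheory HyperbolicToeplitz
open scoped ENNReal

noncomputable section

namespace HyperbolicToeplitz

/-! In the coordinates `z = s (h + i)` dilations act on `s` alone, and the Mellin transform in `s`
diagonalizes them. Write `U = U₂ U₁ U₀`, an isometry by `norm_U1`. The heart of the matter is that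
`U` carries the Bergman space exactly onto the range of `W`, that is, onto functions of `ξ` alone
times the normalizing factor.

That the image lies in the range of `W` is Cauchy's theorem. For holomorphic `g` with enough decay
in sectors, the integrals of `g(z) z ^ (λ/2 - iξ) dz` over all rays from the origin agree, so the
Mellin transform along the ray through `h + i` is `F(ξ, h)` times a function of `ξ` (`mellin_ray`,
`coeFn_U1_U0`). Dividing by `F` removes the dependence on `h`. A general Bergman function satisfies
`|g| ≤ C (Im z) ^ (-(λ/2 + 1))` (`exists_norm_le_im_rpow`), so multiplying it by a bounded rational
cutoff produces the decay, and the closedness of the range of `W` permits removing the cutoff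
(`U_mem_range_W`).

That the image is everything needs only density. The functions `logGaussian` lie in the Bergman
space, and `R` maps them to `exp (-itξ)` times a fixed positive, rapidly decreasing function, up to
a constant. Anything orthogonal to all of them has a weighted version with zero Fourier transform,
hence vanishes by Plancherel (`orthogonal_range_bergmanR`).

Consequently `W R = U` on the Bergman space, `R*` takes values there, and `R* R` is the projection.
A hyperbolic symbol is a function `f` of `h = Re z / Im z` (`IsHyperbolicSymbol.exists_eq_comp`).
Multiplication by `f(h)` commutes with a transform in `s` (`U_mulOp`), and the projection inside
`T_a` is absorbed by `R`. So `R T_a R* = W* M_f W`, which averages `f` against the probability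
density `|F(ξ, ·)|² / V(2ξ, -λ/2)` (`adjoint_W_mulOp_W`). -/

/-! ### The extended Mellin transform and multiplication by functions of `h`. -/

lemma norm_U1 (lam : ℝ) [Fact (-1 < lam)] (φ : Lp ℂ 2 (nuHat lam)) : ‖U1 lam φ‖ = ‖φ‖ := by
  refine (dense_mellinDomain lam).induction_on (p := fun φ => ‖U1 lam φ‖ = ‖φ‖) φ
    (isClosed_eq (by fun_prop) (by fun_prop)) fun φ => ?_
  have : U1 lam ((mellinDomain lam).subtypeL φ) = mellinCore lam φ :=
    ContinuousLinearMap.extend_eq _ (dense_mellinDomain lam)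
      (mellinDomain lam).subtypeₗᵢ.isometry.isUniformInducing φ
  rw [this, LinearIsometry.norm_map]
  rfl

lemma ae_nuHat_pos (lam : ℝ) : ∀ᵐ p ∂(nuHat lam), 0 < p.1 :=
  (Measure.quasiMeasurePreserving_fst (μ := radialMeasure lam) (ν := momentMeasure lam)).ae
    ((withDensity_absolutelyContinuous _ _).ae_le (ae_restrict_mem measurableSet_Ioi))

lemma quasiMeasurePreserving_snd_nuHat (lam : ℝ) :
    Measure.QuasiMeasurePreserving Prod.snd (nuHat lam) volume :=
  (Measure.quasiMeasurePreserving_snd (μ := radialMeasure lam) (ν := momentMeasure lam)).mono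
    Measure.AbsolutelyContinuous.rfl Measure.smul_absolutelyContinuous

lemma quasiMeasurePreserving_snd_rho (lam : ℝ) :
    Measure.QuasiMeasurePreserving Prod.snd (rho lam) volume :=
  (Measure.quasiMeasurePreserving_snd (μ := volume) (ν := momentMeasure lam)).mono
    Measure.AbsolutelyContinuous.rfl Measure.smul_absolutelyContinuous

lemma quasiMeasurePreserving_snd_rhoF (lam : ℝ) :
    Measure.QuasiMeasurePreserving Prod.snd (rhoF lam) volume :=
  (quasiMeasurePreserving_snd_rho lam).mono_left (withDensity_absolutelyContinuous _ _)

lemma memLp_top_exists_bound {α : Type*} [MeasurableSpace α] {μ : Measure α} {q : α → ℂ}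
    (hq : MemLp q ∞ μ) : ∃ C : ℝ, 0 ≤ C ∧ ∀ᵐ x ∂μ, ‖q x‖ ≤ C := by
  refine ⟨(eLpNormEssSup q μ).toReal, ENNReal.toReal_nonneg, ?_⟩
  filter_upwards [enorm_ae_le_eLpNormEssSup q μ] with y hy
  have := hq.2
  rw [eLpNorm_exponent_top] at this
  rw [← toReal_enorm]
  exact ENNReal.toReal_mono this.ne hy

lemma memLp_top_comp {α β : Type*} [MeasurableSpace α] [MeasurableSpace β] {μ : Measure α}
    {ν : Measure β} {g : α → β} (hg : Measure.QuasiMeasurePreserving g μ ν) {q : β → ℂ}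
    (hq : MemLp q ∞ ν) : MemLp (fun x => q (g x)) ∞ μ := by
  obtain ⟨C, -, hC⟩ := memLp_top_exists_bound hq
  exact memLp_top_of_bound (hq.1.comp_quasiMeasurePreserving hg) C (hg.ae hC)

/-- A bounded factor preserves absolute convergence, so both sides of the commutation relation below
are given by Mellin integrals on the same dense domain. -/
lemma mulOp_mem_mellinDomain {lam : ℝ} [hlam : Fact (-1 < lam)] {q : ℝ → ℂ}
    (hq : MemLp q ∞ volume) {φ : Lp ℂ 2 (nuHat lam)} (hφ : φ ∈ mellinDomain lam) :
    mulOp _ (memLp_top_comp (quasiMeasurePreserving_snd_nuHat lam) hq) φ ∈ mellinDomain lam := by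
  obtain ⟨C, -, hC⟩ := memLp_top_exists_bound hq
  have hφ : Integrable (fun p => ((p.1 ^ (lam / 2) : ℝ) : ℂ) * φ p) baseMeasure := hφ
  have hsnd : Measure.QuasiMeasurePreserving Prod.snd baseMeasure volume :=
    Measure.quasiMeasurePreserving_snd
  have h := hφ.bdd_mul (c := C) (hq.1.comp_quasiMeasurePreserving hsnd) (hsnd.ae hC)
  refine h.congr ?_
  filter_upwards [(base_ac hlam.out).ae_le
    (coeFn_mulOp _ (memLp_top_comp (quasiMeasurePreserving_snd_nuHat lam) hq) φ)] with p hp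
  rw [hp]
  simp only [Function.comp_apply]
  ring

lemma partialMellin_mul_snd (lam : ℝ) (q : ℝ → ℂ) (φ : ℝ × ℝ → ℂ) (p : ℝ × ℝ) :
    partialMellin lam (fun p => q p.2 * φ p) p = q p.2 * partialMellin lam φ p := by
  simp only [partialMellin]
  have := mellin_const_smul (fun s => φ (s, p.2)) ((lam : ℂ) / 2 + 1 - I * (p.1 : ℂ)) (q p.2)
  simp only [smul_eq_mul] at this
  rw [this]; ring

/-- The partial Mellin transform commutes with multiplication by functions of `h`. -/
lemma U1_mulOp {lam : ℝ} [hlam : Fact (-1 < lam)] {q : ℝ → ℂ} (hq : MemLp q ∞ volume)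
    (φ : Lp ℂ 2 (nuHat lam)) :
    U1 lam (mulOp _ (memLp_top_comp (quasiMeasurePreserving_snd_nuHat lam) hq) φ) =
      mulOp _ (memLp_top_comp (quasiMeasurePreserving_snd_rho lam) hq) (U1 lam φ) := by
  -- Both sides are continuous in `φ`, so it suffices to take `φ` with convergent Mellin integrals;
  -- there `q(h)` is a constant of the inner integration.
  refine (dense_mellinDomain lam).induction_on (p := fun φ => U1 lam (mulOp _ (memLp_top_comp
    (quasiMeasurePreserving_snd_nuHat lam) hq) φ) = mulOp _ (memLp_top_comp
    (quasiMeasurePreserving_snd_rho lam) hq) (U1 lam φ)) φ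
    (isClosed_eq (by fun_prop) (by fun_prop)) fun φ => ?_
  refine Lp.ext ?_
  have h1 := coeFn_U1 lam _ (mulOp_mem_mellinDomain hq φ.2)
  have h2 := partialMellin_congr hlam.out
    (coeFn_mulOp _ (memLp_top_comp (quasiMeasurePreserving_snd_nuHat lam) hq) φ.1)
  have h3 := coeFn_mulOp _ (memLp_top_comp (quasiMeasurePreserving_snd_rho lam) hq)
    (U1 lam φ.1)
  filter_upwards [h1, h2, h3, coeFn_U1 lam _ φ.2] with p e1 e2 e3 e4
  simp only [Submodule.subtypeL_apply]
  rw [e1, e2, e3, e4, partialMellin_mul_snd]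

/-! ### Group-moment coordinates and the form of hyperbolic symbols. -/

/-- The group-moment coordinates `(Im z, Re z / Im z)` of a point of the half-plane. -/
def momentCoord (z : ℂ) : ℝ × ℝ := (z.im, z.re / z.im)

lemma measurable_momentCoord : Measurable momentCoord := by unfold momentCoord; fun_prop

lemma momentCoord_kappa {p : ℝ × ℝ} (hp : 0 < p.1) : momentCoord (kappa p) = p := by
  have := hp.ne'
  refine Prod.ext ?_ ?_ <;> simp [momentCoord, kappa]
  field_simp

lemma kappa_momentCoord {z : ℂ} (hz : 0 < z.im) : kappa (momentCoord z) = z := by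
  have := hz.ne'
  apply Complex.ext <;> simp [momentCoord, kappa]
  field_simp

lemma kappa_mem {p : ℝ × ℝ} (hp : 0 < p.1) : kappa p ∈ H := by
  have : (kappa p).im = p.1 := by simp [kappa]
  change 0 < (kappa p).im
  rwa [this]

lemma measurePreserving_momentCoord {lam : ℝ} (hlam : -1 < lam) :
    MeasurePreserving momentCoord (vHat lam) (nuHat lam) := by
  refine ⟨measurable_momentCoord, ?_⟩
  rw [← (measurePreserving_kappa hlam).map_eq, Measure.map_map measurable_momentCoord
    measurable_kappa]
  have : momentCoord ∘ kappa =ᵐ[nuHat lam] id := by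
    filter_upwards [ae_nuHat_pos lam] with p hp using momentCoord_kappa hp
  rw [Measure.map_congr this, Measure.map_id]

/-- The density is strictly positive on the half-plane, so the weighted and unweighted measures have
the same null sets. -/
lemma restrict_H_ac {lam : ℝ} (hlam : -1 < lam) : volume.restrict H ≪ vHat lam := by
  have hm : MeasurableSet H := UpperHalfPlane.isOpen_upperHalfPlaneSet.measurableSet
  refine withDensity_absolutelyContinuous' (by fun_prop) ?_
  refine (ae_restrict_mem hm).mono fun z hz => ?_
  have h1 : 0 < cConst lam / 4 := div_pos (cConst_pos hlam) (by norm_num)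
  have h2 : 0 < z.im ^ lam := Real.rpow_pos_of_pos hz _
  have : 0 < cConst lam / 4 * z.im ^ lam := by positivity
  simpa using this

lemma ae_H_iff_ae_nuHat {lam : ℝ} (hlam : -1 < lam) {P : ℂ → Prop} :
    (∀ᵐ z ∂(volume.restrict H), P z) ↔ ∀ᵐ p ∂(nuHat lam), P (kappa p) := by
  have hm : MeasurableSet H := UpperHalfPlane.isOpen_upperHalfPlaneSet.measurableSet
  constructor
  · intro h
    exact (measurePreserving_kappa hlam).quasiMeasurePreserving.ae
      ((vHat_absolutelyContinuous lam).ae_le h)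
  · intro h
    have := (restrict_H_ac hlam).ae_le
      ((measurePreserving_momentCoord hlam).quasiMeasurePreserving.ae h)
    filter_upwards [this, ae_restrict_mem hm] with z h1 h2
    rwa [kappa_momentCoord h2] at h1

lemma nuHat_ac (lam : ℝ) : nuHat lam ≪ baseMeasure :=
  Measure.AbsolutelyContinuous.prod (withDensity_absolutelyContinuous _ _)
    Measure.smul_absolutelyContinuous

lemma lintegral_Ioi_comp_mul {r : ℝ} (hr : 0 < r) (g : ℝ → ℝ≥0∞) :
    ENNReal.ofReal r * ∫⁻ s in Ioi 0, g (r * s) = ∫⁻ s in Ioi 0, g s := by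
  have key := lintegral_image_eq_lintegral_abs_deriv_mul (s := Ioi (0 : ℝ))
    (f := fun h : ℝ => r * h) (f' := fun _ => r) measurableSet_Ioi
    (fun x _ => ((hasDerivAt_id x).const_mul r |>.congr_deriv (by simp)).hasDerivWithinAt)
    (fun a _ b _ hab => mul_left_cancel₀ hr.ne' hab) g
  rw [abs_of_pos hr, lintegral_const_mul' _ _ ENNReal.ofReal_ne_top] at key
  rw [← key]
  congr 2
  ext x
  simp only [mem_image, mem_Ioi]
  constructor
  · rintro ⟨y, hy, rfl⟩; positivity
  · intro hx; exact ⟨x / r, by positivity, by field_simp⟩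

lemma ofReal_mul_kappa (t : ℝ) (p : ℝ × ℝ) : (t : ℂ) * kappa p = kappa (t * p.1, p.2) := by
  simp [kappa, mul_assoc]

lemma ae_H_iff_ae_base {P : ℂ → Prop} :
    (∀ᵐ z ∂(volume.restrict H), P z) ↔ ∀ᵐ p ∂baseMeasure, P (kappa p) := by
  have h0 : (-1 : ℝ) < 0 := by norm_num
  rw [ae_H_iff_ae_nuHat h0]
  exact ⟨fun h => (base_ac h0).ae_le h, fun h => (nuHat_ac 0).ae_le h⟩

lemma quasiMeasurePreserving_mul_Ioi {t : ℝ} (ht : 0 < t) :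
    Measure.QuasiMeasurePreserving (fun s : ℝ => t * s) (volume.restrict (Ioi 0))
      (volume.restrict (Ioi 0)) := by
  refine ⟨by fun_prop, Measure.AbsolutelyContinuous.mk fun A hA h0 => ?_⟩
  rw [Measure.map_apply (by fun_prop) hA]
  have h := lintegral_Ioi_comp_mul ht (A.indicator 1)
  rw [lintegral_indicator_one hA, h0] at h
  rw [← lintegral_indicator_one (hA.preimage (by fun_prop))]
  have ht' : ENNReal.ofReal t ≠ 0 := by simpa using ht
  exact (mul_eq_zero.1 h).resolve_left ht'

lemma quasiMeasurePreserving_mul_base {t : ℝ} (ht : 0 < t) :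
    Measure.QuasiMeasurePreserving (fun p : ℝ × ℝ => (t * p.1, p.2)) baseMeasure baseMeasure := by
  have h := quasiMeasurePreserving_mul_Ioi ht
  refine ⟨by fun_prop, ?_⟩
  have e : (fun p : ℝ × ℝ => (t * p.1, p.2)) = Prod.map (fun s => t * s) id := rfl
  rw [e, baseMeasure, ← Measure.map_prod_map _ _ (by fun_prop) measurable_id, Measure.map_id]
  exact h.2.prod Measure.AbsolutelyContinuous.rfl

/-- A hyperbolic symbol is almost everywhere a function of `Re z / Im z`. -/
lemma IsHyperbolicSymbol.exists_eq_comp {a : ℂ → ℂ}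
    (ha : AEStronglyMeasurable a (volume.restrict H)) (hinv : IsHyperbolicSymbol a) :
    ∃ f : ℝ → ℂ, Measurable f ∧ ∀ᵐ z ∂(volume.restrict H), a z = f (z.re / z.im) := by
  -- The symbol is replaced by a measurable version, which can be restricted to a single horizontal
  -- line.
  obtain ⟨b, hb, hab⟩ := ha
  have hbm := hb.measurable
  have hk := measurable_kappa
  have hab' := ae_H_iff_ae_base.1 hab
  -- invariance of `b` under each dilation
  have h1 : ∀ t : ℝ, 0 < t → ∀ᵐ p ∂baseMeasure, b (kappa (t * p.1, p.2)) = b (kappa p) := by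
    intro t ht
    filter_upwards [hab', (quasiMeasurePreserving_mul_base ht).ae hab',
      ae_H_iff_ae_base.1 (hinv t ht)] with p e1 e2 e3
    rw [← e1, ← e2, ← e3, ofReal_mul_kappa]
  have hS : MeasurableSet {q : ℝ × ℝ × ℝ | b (kappa (q.1 * q.2.1, q.2.2)) = b (kappa q.2)} :=
    measurableSet_eq_fun (by fun_prop) (by fun_prop)
  -- The exceptional null set depends on the dilation `t`; Fubini collects these uncountably many
  -- sets into one null set of triples `(t, s, h)`.
  have h2 : ∀ᵐ q ∂((volume.restrict (Ioi (0 : ℝ))).prod baseMeasure),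
      b (kappa (q.1 * q.2.1, q.2.2)) = b (kappa q.2) := by
    have : SFinite baseMeasure := by unfold baseMeasure; infer_instance
    rw [Measure.ae_prod_iff_ae_ae hS]
    filter_upwards [ae_restrict_mem measurableSet_Ioi] with t ht using h1 t ht
  -- exchange the order, so that the base point is fixed first
  have h3 : ∀ᵐ q ∂((volume.restrict (Ioi (0 : ℝ))).prod baseMeasure),
      b (kappa (q.2.1 * q.1, q.2.2)) = b (kappa (q.1, q.2.2)) := by
    have hq : Measure.QuasiMeasurePreserving
        (fun q : ℝ × ℝ × ℝ => ((q.2.1, q.1, q.2.2) : ℝ × ℝ × ℝ))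
        ((volume.restrict (Ioi (0 : ℝ))).prod baseMeasure)
        ((volume.restrict (Ioi (0 : ℝ))).prod baseMeasure) := by
      have A := (measurePreserving_prodAssoc (volume.restrict (Ioi (0 : ℝ)))
        (volume.restrict (Ioi (0 : ℝ))) (volume : Measure ℝ))
      have B := (Measure.measurePreserving_swap (μ := volume.restrict (Ioi (0 : ℝ)))
        (ν := volume.restrict (Ioi (0 : ℝ)))).prod (MeasurePreserving.id (volume : Measure ℝ))
      exact ((A.comp B).comp A.symm).quasiMeasurePreserving
    exact hq.ae h2
  have : SFinite baseMeasure := by unfold baseMeasure; infer_instance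
  have h4 := Measure.ae_ae_of_ae_prod h3
  have : NeZero (volume.restrict (Ioi (0 : ℝ))) := ⟨by
    intro h
    simp at h⟩
  -- One good height `s` is enough: for almost all `(t, h)` the value at `(t s, h)` equals that at
  -- `(s, h)`, and the first point runs over the whole half-plane.
  obtain ⟨s, hs, hs0⟩ := (h4.and (ae_restrict_mem measurableSet_Ioi)).exists
  have hs0 : 0 < s := hs0
  refine ⟨fun h => b (kappa (s, h)), by fun_prop, ae_H_iff_ae_base.2 ?_⟩
  have h5 := (quasiMeasurePreserving_mul_base (inv_pos.2 hs0)).ae hs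
  have hpos : ∀ᵐ p ∂baseMeasure, 0 < p.1 := (base_ac (lam := 0) (by norm_num)).ae_le
    (ae_nuHat_pos 0)
  filter_upwards [h5, hab', hpos] with p e1 e2 e3
  have e4 : (kappa p).re / (kappa p).im = p.2 := congrArg Prod.snd (momentCoord_kappa e3)
  rw [e2, e4, ← e1]
  congr 2
  refine Prod.ext ?_ rfl
  simp only
  field_simp

/-! ### Affine covariance and the growth of Bergman functions. -/

lemma lintegral_vHat {lam : ℝ} (hlam : -1 < lam) {g : ℂ → ℝ≥0∞} (hg : Measurable g) :
    ∫⁻ z, g z ∂(vHat lam) = ∫⁻ s in Ioi 0, ENNReal.ofReal (s ^ (1 + lam)) *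
      ∫⁻ h, g (kappa (s, h)) ∂(momentMeasure lam) := by
  rw [← (measurePreserving_kappa hlam).lintegral_comp hg, nuHat,
    lintegral_prod (fun a => g (kappa a)) (hg.comp measurable_kappa).aemeasurable,
    lintegral_radialMeasure]

/-- The dilation contributes `s ^ 2` from area and `s ^ λ` from the weight. A horizontal translation
by `x` is, at height `s t`, the shift of `h` by `x / (s t)`, which Lebesgue measure in `h` does not
see. -/
lemma lintegral_vHat_comp_affine {lam : ℝ} (hlam : -1 < lam) {g : ℂ → ℝ≥0∞} (hg : Measurable g)
    {s : ℝ} (hs : 0 < s) (x : ℝ) :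
    ENNReal.ofReal (s ^ (2 + lam)) * ∫⁻ z, g (s * z + x) ∂(vHat lam) = ∫⁻ z, g z ∂(vHat lam) := by
  rw [lintegral_vHat hlam hg, lintegral_vHat hlam (g := fun z => g (s * z + x)) (by fun_prop),
    ← lintegral_Ioi_comp_mul hs (fun s => ENNReal.ofReal (s ^ (1 + lam)) *
      ∫⁻ h, g (kappa (s, h)) ∂(momentMeasure lam)), show 2 + lam = 1 + (1 + lam) by ring,
    Real.rpow_add hs, Real.rpow_one, ENNReal.ofReal_mul hs.le, mul_assoc]
  congr 1
  rw [← lintegral_const_mul' _ _ ENNReal.ofReal_ne_top]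
  refine setLIntegral_congr_fun measurableSet_Ioi fun t ht => ?_
  have ht : 0 < t := ht
  rw [← mul_assoc, ← ENNReal.ofReal_mul (by positivity), ← Real.mul_rpow hs.le ht.le]
  congr 1
  simp only [lintegral_momentMeasure]
  congr 1
  rw [← lintegral_add_right_eq_self (fun h => g (kappa (s * t, h))) (x / (s * t))]
  refine lintegral_congr fun h => ?_
  congr 1
  have h1 : (s : ℂ) ≠ 0 := by exact_mod_cast hs.ne'
  have h2 : (t : ℂ) ≠ 0 := by exact_mod_cast ht.ne'
  simp only [kappa]
  push_cast
  field_simp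
  ring

lemma eLpNorm_two_eq {α : Type*} [MeasurableSpace α] {μ : Measure α} (f : α → ℂ) :
    eLpNorm f 2 μ = (∫⁻ x, ‖f x‖ₑ ^ 2 ∂μ) ^ (1 / 2 : ℝ) := by
  rw [eLpNorm_eq_lintegral_rpow_enorm_toReal (by norm_num) (by norm_num)]
  simp

/-- Holomorphic functions in `L²(ℍ, v̂_λ)` are bounded by a multiple of `(Im z) ^ (-(λ/2 + 1))`. -/
lemma exists_norm_le_im_rpow {lam : ℝ} (hlam : -1 < lam) {g : ℂ → ℂ} (hg : DifferentiableOn ℂ g H)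
    (hgm : Measurable g) (hg2 : MemLp g 2 (vHat lam)) :
    ∃ C : ℝ, 0 ≤ C ∧ ∀ z ∈ H, ‖g z‖ ≤ C * z.im ^ (-(lam / 2 + 1)) := by
  have hI : I ∈ H := by change 0 < I.im; simp
  obtain ⟨r, hr, C, hC, -, h⟩ := enorm_le_eLpNorm hlam hI
  set N := eLpNorm g 2 (vHat lam) with hN
  have hNt : C * N ≠ ∞ := ENNReal.mul_ne_top hC hg2.2.ne
  refine ⟨(C * N).toReal, ENNReal.toReal_nonneg, fun z hz => ?_⟩
  have hz : 0 < z.im := hz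
  set s := z.im with hs
  -- The affine map sends `i` to `z`, so the point evaluation bound at `i` alone gives the bound at
  -- every point, with the power of `Im z` coming from the scaling of the norm.
  have hd : DifferentiableOn ℂ (fun w => g (s * w + z.re)) H := by
    refine hg.comp (by fun_prop) fun w hw => ?_
    have hw : 0 < w.im := hw
    have : 0 < s * w.im := mul_pos hz hw
    change 0 < (s * w + z.re : ℂ).im
    simpa using this
  have h1 := h _ hd I (Metric.mem_ball_self hr)
  have e1 : (s * I + z.re : ℂ) = z := by apply Complex.ext <;> simp [hs]
  have e2 : eLpNorm (fun w => g (s * w + z.re)) 2 (vHat lam) =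
      ENNReal.ofReal (s ^ (-(lam / 2 + 1))) * N := by
    have h2 := lintegral_vHat_comp_affine hlam (g := fun z => ‖g z‖ₑ ^ 2) (by fun_prop) hz z.re
    rw [hN, eLpNorm_two_eq, eLpNorm_two_eq, ← h2, ENNReal.mul_rpow_of_nonneg _ _ (by norm_num),
      ENNReal.ofReal_rpow_of_pos (by positivity), ← Real.rpow_mul hz.le, ← mul_assoc,
      ← ENNReal.ofReal_mul (by positivity), ← Real.rpow_add hz,
      show -(lam / 2 + 1) + (2 + lam) * (1 / 2) = 0 by ring]
    simp
  rw [e1, e2] at h1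
  have h3 : ‖g z‖ₑ ≤ ENNReal.ofReal ((C * N).toReal * s ^ (-(lam / 2 + 1))) := by
    rw [ENNReal.ofReal_mul ENNReal.toReal_nonneg, ENNReal.ofReal_toReal hNt]
    refine h1.trans (le_of_eq (by ring))
  rw [← ofReal_norm] at h3
  exact (ENNReal.ofReal_le_ofReal_iff (by positivity)).1 h3

/-! ### Contour shift: Mellin transforms along rays. -/

/-- The vertical sides of the rectangle contribute nothing in the limit. The filter is left general
to serve both `x → ∞` and `x → -∞`. -/
lemma re_add_mul_I_tendsto_vertical {P : ℂ → ℂ} {θ₁ θ₂ C : ℝ}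
    (hb : ∀ x θ : ℝ, θ ∈ uIcc θ₁ θ₂ → ‖P (x + θ * I)‖ ≤ C / (1 + x ^ 2)) {l : Filter ℝ}
    (hl : Tendsto (fun x : ℝ => x ^ 2) l atTop) :
    Tendsto (fun x : ℝ => ∫ y in θ₁..θ₂, P (x + y * I)) l (𝓝 0) := by
  have h0 : Tendsto (fun x : ℝ => C / (1 + x ^ 2) * |θ₂ - θ₁|) l (𝓝 0) := by
    have := (tendsto_const_nhds (x := C) (f := l)).div_atTop
      (tendsto_atTop_add_const_left l 1 hl)
    simpa using this.mul_const |θ₂ - θ₁|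
  refine squeeze_zero_norm (fun x => ?_) h0
  exact intervalIntegral.norm_integral_le_of_norm_le_const
    fun y hy => hb x y (uIoc_subset_uIcc hy)

/-- The integral of a holomorphic function over horizontal lines in a strip in which it decays does
not depend on the line. -/
lemma integral_horizontal_eq {P : ℂ → ℂ} {θ₁ θ₂ C : ℝ}
    (hP : DifferentiableOn ℂ P (univ ×ℂ uIcc θ₁ θ₂))
    (hb : ∀ x θ : ℝ, θ ∈ uIcc θ₁ θ₂ → ‖P (x + θ * I)‖ ≤ C / (1 + x ^ 2)) :
    ∫ x : ℝ, P (x + θ₁ * I) = ∫ x : ℝ, P (x + θ₂ * I) := by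
  have hint : ∀ θ ∈ uIcc θ₁ θ₂, Integrable fun x : ℝ => P (x + θ * I) := fun θ hθ => by
    refine (integrable_inv_one_add_sq.const_mul C).mono' ?_ (Eventually.of_forall fun x => ?_)
    · refine Continuous.aestronglyMeasurable ?_
      refine hP.continuousOn.comp_continuous (by fun_prop) fun x => ?_
      simpa [mem_reProdIm] using hθ
    · exact hb x θ hθ
  have hlim : ∀ θ ∈ uIcc θ₁ θ₂, Tendsto (fun T : ℝ => ∫ x in (-T)..T, P (x + θ * I)) atTop
      (𝓝 (∫ x : ℝ, P (x + θ * I))) := fun θ hθ =>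
    intervalIntegral_tendsto_integral (hint θ hθ) tendsto_neg_atTop_atBot tendsto_id
  have hsq : Tendsto (fun x : ℝ => x ^ 2) atTop atTop := tendsto_pow_atTop two_ne_zero
  have hv1 := re_add_mul_I_tendsto_vertical hb hsq
  have hv2 : Tendsto (fun x : ℝ => ∫ y in θ₁..θ₂, P ((-x : ℝ) + y * I)) atTop (𝓝 0) :=
    (re_add_mul_I_tendsto_vertical hb (l := atBot)
      (by simpa [Function.comp_def] using hsq.comp tendsto_neg_atBot_atTop)).comp tendsto_neg_atTop_atBot
  have h := (((hlim θ₁ left_mem_uIcc).sub (hlim θ₂ right_mem_uIcc)).add (hv1.const_smul I)).sub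
    (hv2.const_smul I)
  -- Cauchy's theorem on the rectangle with real parts in `[-T, T]`.
  have hz : ∀ T : ℝ, (∫ x in (-T)..T, P (x + θ₁ * I)) - (∫ x in (-T)..T, P (x + θ₂ * I)) +
      I • (∫ y in θ₁..θ₂, P (T + y * I)) - I • (∫ y in θ₁..θ₂, P ((-T : ℝ) + y * I)) = 0 := by
    intro T
    have := Complex.integral_boundary_rect_eq_zero_of_differentiableOn P ((-T : ℝ) + θ₁ * I)
      (T + θ₂ * I) (hP.mono fun z hz => by
        simp only [mem_reProdIm] at hz ⊢
        exact ⟨mem_univ _, by simpa using hz.2⟩)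
    simpa using this
  simp only [hz] at h
  have := tendsto_nhds_unique h tendsto_const_nhds
  simpa [sub_eq_zero] using this

/-- `|z| ^ (λ/2 + 1) g(z)` decays at `0` and at `∞` in every sector `|Re z| ≤ c Im z`. -/
def HasSectorDecay (lam : ℝ) (g : ℂ → ℂ) : Prop :=
  ∀ c : ℝ, ∃ C : ℝ, 0 ≤ C ∧ ∀ z ∈ H, |z.re| ≤ c * z.im →
    ‖g z‖ * ‖z‖ ^ (lam / 2 + 1) ≤ C * (‖z‖ / (1 + ‖z‖ ^ 2))

/-- The integral of `g(z) z ^ (λ/2 - iξ)` over the positive imaginary half-axis, in the variable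
`log z`. -/
def rayIntegral (lam : ℝ) (g : ℂ → ℂ) (ξ : ℝ) : ℂ :=
  ∫ x : ℝ, g (exp (x + (Real.pi / 2 : ℝ) * I)) *
    exp (((lam : ℂ) / 2 + 1 - I * ξ) * (x + (Real.pi / 2 : ℝ) * I))

lemma measurable_rayIntegral (lam : ℝ) {g : ℂ → ℂ} (hg : Measurable g) :
    Measurable (rayIntegral lam g) := by
  unfold rayIntegral
  refine (StronglyMeasurable.integral_prod_right' (f := fun q : ℝ × ℝ =>
    g (exp (q.2 + (Real.pi / 2 : ℝ) * I)) *
    exp (((lam : ℂ) / 2 + 1 - I * q.1) * (q.2 + (Real.pi / 2 : ℝ) * I))) ?_).measurable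
  exact Measurable.stronglyMeasurable (by fun_prop)

/-- The substitution `s = exp x` turns rays from the origin into horizontal lines, for which the
contour shift is stated. -/
lemma mellin_eq_integral_exp (f : ℝ → ℂ) (s : ℂ) :
    mellin f s = ∫ x : ℝ, exp (s * x) * f (Real.exp x) := by
  have hi : Ioi (0 : ℝ) = Real.exp '' univ := by rw [image_univ, Real.range_exp]
  rw [mellin, hi, integral_image_eq_integral_abs_deriv_smul MeasurableSet.univ
    (fun x _ => (Real.hasDerivAt_exp x).hasDerivWithinAt) Real.exp_injective.injOn,
    setIntegral_univ]
  refine integral_congr_ae (Eventually.of_forall fun x => ?_)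
  have h0 : (Real.exp x : ℂ) ≠ 0 := by exact_mod_cast (Real.exp_pos x).ne'
  simp only [abs_of_pos (Real.exp_pos x), smul_eq_mul, Complex.real_smul]
  rw [← mul_assoc]
  congr 1
  rw [Complex.cpow_def_of_ne_zero h0, ← Complex.ofReal_log (Real.exp_pos x).le, Real.log_exp,
    Complex.ofReal_exp, ← Complex.exp_add]
  congr 1; ring

/-- The left side is `1 / (exp x + exp (-x))`, and `exp |x| ≥ 1 + |x| + x² / 2`. This converts
sector decay in `|z| = exp x` into the decay required on the strip. -/
lemma exp_div_le (x : ℝ) : Real.exp x / (1 + Real.exp x ^ 2) ≤ 2 / (1 + x ^ 2) := by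
  rw [div_le_div_iff₀ (by positivity) (by positivity)]
  have hpos := Real.exp_pos x
  rcases le_total 0 x with h | h
  · have := Real.quadratic_le_exp_of_nonneg h
    nlinarith
  · have h1 := Real.quadratic_le_exp_of_nonneg (neg_nonneg.2 h)
    have h2 : Real.exp x * Real.exp (-x) = 1 := by rw [← Real.exp_add]; simp
    nlinarith

lemma log_I_add (h : ℝ) :
    Complex.log (I + (h : ℂ)) = (Real.log ‖I + (h : ℂ)‖ : ℝ) + (arccot h : ℝ) * I := by
  apply Complex.ext <;> simp [Complex.log_re, Complex.log_im, arg_I_add]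

lemma kappa_exp (x h : ℝ) : kappa (Real.exp x, h) = exp (x + Complex.log (I + (h : ℂ))) := by
  rw [Complex.exp_add, Complex.exp_log (I_add_ne_zero h), kappa]
  push_cast
  ring

lemma exp_mem_H {x θ : ℝ} (h : θ ∈ Ioo 0 Real.pi) : exp (x + θ * I) ∈ H := by
  change 0 < (exp (x + θ * I)).im
  rw [Complex.exp_im]
  have := Real.sin_pos_of_mem_Ioo h
  simp only [add_re, ofReal_re, mul_re, I_re, mul_zero, ofReal_im, I_im, mul_one, sub_self,
    add_zero, add_im, mul_im, zero_add]
  positivity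

/-- The Mellin transforms of `g` along rays from the origin are proportional. -/
lemma mellin_ray {lam : ℝ} {g : ℂ → ℂ} (hg : DifferentiableOn ℂ g H) (hd : HasSectorDecay lam g)
    (ξ h : ℝ) : mellin (fun s => g (kappa (s, h))) ((lam : ℂ) / 2 + 1 - I * ξ) =
      F lam (ξ, h) * rayIntegral lam g ξ := by
  set μ : ℂ := (lam : ℂ) / 2 + 1 - I * ξ with hμ
  set P : ℂ → ℂ := fun w => g (exp w) * exp (μ * w) with hP
  set r : ℝ := Real.log ‖I + (h : ℂ)‖ with hr
  set θ : ℝ := arccot h with hθ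
  have hsub : uIcc θ (Real.pi / 2) ⊆ Ioo 0 Real.pi :=
    ordConnected_Ioo.uIcc_subset ⟨arccot_pos h, arccot_lt_pi h⟩
      ⟨by positivity, by linarith [Real.pi_pos]⟩
  -- With `log (i + h) = r + iθ`, the ray is the line at height `θ`. Translating `x` by `r` absorbs
  -- the modulus, and the factor left over, `exp (-μ (r + iθ))`, is exactly `F(ξ, h)`.
  have h1 : mellin (fun s => g (kappa (s, h))) μ = F lam (ξ, h) * ∫ x : ℝ, P (x + θ * I) := by
    rw [mellin_eq_integral_exp, ← integral_add_right_eq_self (fun x : ℝ => P (x + θ * I)) r,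
      ← integral_const_mul]
    refine integral_congr_ae (Eventually.of_forall fun x => ?_)
    have e1 : F lam (ξ, h) = exp (-μ * ((r : ℂ) + θ * I)) := by
      rw [F, Complex.cpow_def_of_ne_zero (I_add_ne_zero h), log_I_add]
      congr 1
      simp only [hμ, ← hr, ← hθ]; ring
    simp only [hP]
    rw [kappa_exp, log_I_add, e1, ← hr, ← hθ]
    push_cast
    rw [show (x : ℂ) + (r + θ * I) = x + r + θ * I by ring, mul_left_comm, ← Complex.exp_add,
      mul_comm]
    congr 2; ring
  rw [h1]
  congr 1
  -- The angles between `arccot h` and `π / 2` form a compact subset of `(0, π)`, so the cotangent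
  -- is bounded there and one sector `|Re z| ≤ c Im z` contains all the rays involved.
  obtain ⟨c, hc⟩ := isCompact_uIcc.exists_bound_of_continuousOn (s := uIcc θ (Real.pi / 2))
    (f := fun t => Real.cos t / Real.sin t) (Real.continuous_cos.continuousOn.div
      Real.continuous_sin.continuousOn fun t ht => (Real.sin_pos_of_mem_Ioo (hsub ht)).ne')
  obtain ⟨C, hC0, hC⟩ := hd c
  refine integral_horizontal_eq (P := P) (C := 2 * C * Real.exp (|ξ| * Real.pi)) ?_ ?_
  · refine DifferentiableOn.mul (hg.comp (by fun_prop) fun w hw => ?_) (by fun_prop)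
    have := exp_mem_H (x := w.re) (hsub hw.2)
    rwa [Complex.re_add_im] at this
  · intro x t ht
    have ht' := hsub ht
    have hs := Real.sin_pos_of_mem_Ioo ht'
    have e1 : ‖exp (x + t * I)‖ = Real.exp x := by simp [Complex.norm_exp]
    have e2 : ‖exp (μ * (x + t * I))‖ = Real.exp x ^ (lam / 2 + 1) * Real.exp (ξ * t) := by
      rw [Complex.norm_exp, ← Real.exp_mul, ← Real.exp_add]
      congr 1
      simp [hμ]; ring
    have e3 := hC _ (exp_mem_H (x := x) ht') (by
      have := hc t ht
      rw [Real.norm_eq_abs, abs_div, abs_of_pos hs, div_le_iff₀ hs] at this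
      simp only [Complex.exp_re, Complex.exp_im, abs_mul, abs_of_pos (Real.exp_pos _)]
      simp only [add_re, ofReal_re, mul_re, I_re, mul_zero, ofReal_im, I_im, mul_one, sub_self,
        add_zero, add_im, mul_im, zero_add]
      nlinarith [Real.exp_pos x])
    rw [e1] at e3
    have e4 : Real.exp (ξ * t) ≤ Real.exp (|ξ| * Real.pi) := by
      refine Real.exp_le_exp.2 ?_
      calc ξ * t ≤ |ξ| * t := mul_le_mul_of_nonneg_right (le_abs_self _) ht'.1.le
        _ ≤ _ := mul_le_mul_of_nonneg_left ht'.2.le (abs_nonneg _)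
    simp only [hP]
    rw [norm_mul, e2, ← mul_assoc]
    calc _ ≤ C * (2 / (1 + x ^ 2)) * Real.exp (|ξ| * Real.pi) := by
          refine mul_le_mul (e3.trans ?_) e4 (by positivity) (by positivity)
          exact mul_le_mul_of_nonneg_left (exp_div_le x) hC0
      _ = _ := by ring

/-! ### The Mellin transform of functions with sector decay. -/

lemma norm_kappa_ge {p : ℝ × ℝ} (hp : 0 < p.1) : p.1 ≤ ‖kappa p‖ := by
  have h := Complex.abs_im_le_norm (kappa p)
  have e : (kappa p).im = p.1 := by simp [kappa]
  rwa [e, abs_of_pos hp] at h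

lemma abs_re_kappa {p : ℝ × ℝ} (hp : 0 < p.1) : |(kappa p).re| = |p.2| * (kappa p).im := by
  simp [kappa, abs_mul, abs_of_pos hp, mul_comm]

lemma norm_kappa_le {p : ℝ × ℝ} (hp : 0 < p.1) : ‖kappa p‖ ≤ (1 + |p.2|) * p.1 := by
  have h := Complex.norm_le_abs_re_add_abs_im (kappa p)
  have e : (kappa p).im = p.1 := by simp [kappa]
  rw [abs_re_kappa hp, e, abs_of_pos hp] at h
  linarith

lemma coeFn_U0 (lam : ℝ) [hlam : Fact (-1 < lam)] (f : Lp ℂ 2 (vHat lam)) :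
    U0 lam f =ᵐ[nuHat lam] fun p => f (kappa p) :=
  Lp.coeFn_compMeasurePreserving f (measurePreserving_kappa hlam.out)

lemma coeFn_U0_toLp {lam : ℝ} [hlam : Fact (-1 < lam)] {g : ℂ → ℂ} (hg : MemLp g 2 (vHat lam)) :
    U0 lam (hg.toLp g) =ᵐ[nuHat lam] fun p => g (kappa p) := by
  filter_upwards [coeFn_U0 lam (hg.toLp g),
    (measurePreserving_kappa hlam.out).quasiMeasurePreserving.ae hg.coeFn_toLp] with p h1 h2
  rw [h1, h2]

lemma memLp_indicator_Icc (c : ℝ) : MemLp ((Icc (-c) c).indicator (1 : ℝ → ℂ)) ∞ volume := by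
  refine memLp_top_of_bound (measurable_one.indicator measurableSet_Icc).aestronglyMeasurable 1
    (Eventually.of_forall fun x => ?_)
  by_cases hx : x ∈ Icc (-c) c <;> simp [hx]

/-- The decay constants depend on the sector, so joint integrability in `(s, h)` is available only
after restricting to `|h| ≤ c`. There `|z|` is comparable to `s`, and `s ^ (λ/2) |g|` is dominated
by a multiple of `1 / (1 + s²)`. -/
lemma truncation_mem_mellinDomain {lam : ℝ} [hlam : Fact (-1 < lam)] {g : ℂ → ℂ}
    (hgm : Measurable g) (hd : HasSectorDecay lam g) (hg2 : MemLp g 2 (vHat lam)) (c : ℝ) :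
    mulOp _ (memLp_top_comp (quasiMeasurePreserving_snd_nuHat lam) (memLp_indicator_Icc c))
      (U0 lam (hg2.toLp g)) ∈ mellinDomain lam := by
  obtain ⟨C, hC0, hC⟩ := hd c
  have hk := measurable_kappa
  have hcoe := coeFn_mulOp _ (memLp_top_comp (quasiMeasurePreserving_snd_nuHat lam)
    (memLp_indicator_Icc c)) (U0 lam (hg2.toLp g))
  have hpos : ∀ᵐ p ∂baseMeasure, 0 < p.1 := (base_ac hlam.out).ae_le (ae_nuHat_pos lam)
  have hB : Integrable (fun p : ℝ × ℝ => (C * (1 + |c|) * (1 + p.1 ^ 2)⁻¹) *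
      (Icc (-c) c).indicator (1 : ℝ → ℝ) p.2) baseMeasure := by
    refine Integrable.mul_prod (integrable_inv_one_add_sq.const_mul _).integrableOn ?_
    exact (integrable_indicator_iff measurableSet_Icc).2 (integrableOn_const (by simp))
  have hm : Measurable fun p : ℝ × ℝ => ((p.1 ^ (lam / 2) : ℝ) : ℂ) *
      ((Icc (-c) c).indicator (1 : ℝ → ℂ) p.2 * g (kappa p)) := by
    have : Measurable ((Icc (-c) c).indicator (1 : ℝ → ℂ)) :=
      measurable_one.indicator measurableSet_Icc
    fun_prop
  refine (hB.mono' hm.aestronglyMeasurable ?_).congr ?_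
  · filter_upwards [hpos] with p hp
    by_cases hpc : p.2 ∈ Icc (-c) c
    · have hc : |p.2| ≤ c := abs_le.2 hpc
      have hn := norm_kappa_ge hp
      have hn0 : 0 < ‖kappa p‖ := hp.trans_le hn
      have e := hC _ (kappa_mem hp) (by
        rw [abs_re_kappa hp]
        exact mul_le_mul_of_nonneg_right hc (kappa_mem hp).le)
      have e1 : p.1 ^ (lam / 2 + 1) ≤ ‖kappa p‖ ^ (lam / 2 + 1) :=
        Real.rpow_le_rpow hp.le hn (by linarith [hlam.out])
      have e2 : ‖kappa p‖ / (1 + ‖kappa p‖ ^ 2) ≤ (1 + |c|) * p.1 * (1 + p.1 ^ 2)⁻¹ := by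
        rw [← div_eq_mul_inv]
        refine div_le_div₀ (by positivity) ((norm_kappa_le hp).trans ?_) (by positivity)
          (by gcongr)
        exact mul_le_mul_of_nonneg_right (by linarith [le_abs_self c]) hp.le
      rw [indicator_of_mem hpc, indicator_of_mem hpc]
      simp only [Pi.one_apply, one_mul, mul_one]
      rw [norm_mul, Complex.norm_real, Real.norm_of_nonneg (by positivity)]
      have e3 : ‖g (kappa p)‖ * p.1 ^ (lam / 2 + 1) ≤ C * ((1 + |c|) * p.1 * (1 + p.1 ^ 2)⁻¹) :=
        (mul_le_mul_of_nonneg_left e1 (norm_nonneg _)).trans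
          (e.trans (mul_le_mul_of_nonneg_left e2 hC0))
      rw [Real.rpow_add hp, Real.rpow_one] at e3
      -- Sector decay controls `s ^ (λ/2 + 1) |g|` by a multiple of `s / (1 + s²)`; a factor `s` is
      -- cancelled.
      refine le_of_mul_le_mul_right ?_ hp
      calc _ = ‖g (kappa p)‖ * (p.1 ^ (lam / 2) * p.1) := by ring
        _ ≤ _ := e3
        _ = _ := by ring
    · simp [indicator_of_notMem hpc]
  · filter_upwards [(base_ac hlam.out).ae_le hcoe,
      (base_ac hlam.out).ae_le (coeFn_U0_toLp hg2)] with p h1 h2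
    rw [h1, h2]

/-- The Mellin transform of a holomorphic function that decays in sectors. -/
lemma coeFn_U1_U0 {lam : ℝ} [hlam : Fact (-1 < lam)] {g : ℂ → ℂ} (hg : DifferentiableOn ℂ g H)
    (hgm : Measurable g) (hd : HasSectorDecay lam g) (hg2 : MemLp g 2 (vHat lam)) :
    U1 lam (U0 lam (hg2.toLp g)) =ᵐ[rho lam]
      fun p => F lam p * (((Real.sqrt (2 * Real.pi))⁻¹ : ℂ) * rayIntegral lam g p.1) := by
  -- The image under `U₀` need not lie in the domain of absolute convergence, but its truncations
  -- do. Truncation in `h` commutes with `U₁`, so the formula holds on each strip, and countably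
  -- many strips cover the plane.
  have key : ∀ n : ℕ, ∀ᵐ p ∂(rho lam), p.2 ∈ Icc (-(n : ℝ)) n →
      U1 lam (U0 lam (hg2.toLp g)) p =
        F lam p * (((Real.sqrt (2 * Real.pi))⁻¹ : ℂ) * rayIntegral lam g p.1) := by
    intro n
    have h1 := coeFn_U1 lam _ (truncation_mem_mellinDomain hgm hd hg2 n)
    rw [U1_mulOp (memLp_indicator_Icc n)] at h1
    have h2 := coeFn_mulOp _ (memLp_top_comp (quasiMeasurePreserving_snd_rho lam)
      (memLp_indicator_Icc n)) (U1 lam (U0 lam (hg2.toLp g)))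
    have h3 := partialMellin_congr hlam.out ((coeFn_mulOp _ (memLp_top_comp
      (quasiMeasurePreserving_snd_nuHat lam) (memLp_indicator_Icc n))
      (U0 lam (hg2.toLp g))).trans ((coeFn_U0_toLp hg2).mono fun p hp => by
        change _ = (fun p : ℝ × ℝ => (Icc (-(n : ℝ)) n).indicator (1 : ℝ → ℂ) p.2 *
          g (kappa p)) p
        simp only
        rw [hp]))
    filter_upwards [h1, h2, h3] with p e1 e2 e3 hp
    rw [e2, e3, partialMellin_mul_snd, indicator_of_mem hp] at e1
    simp only [Pi.one_apply, one_mul] at e1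
    rw [e1, partialMellin, mellin_ray hg hd]
    ring
  filter_upwards [ae_all_iff.2 key] with p hp
  obtain ⟨n, hn⟩ := exists_nat_ge |p.2|
  exact hp n (abs_le.1 hn)

/-! ### Comparison of `U` with `W`. -/

/-- The factor `√(2 (2π) / ((λ + 1) V(2ξ, -λ/2)))` in the definition of `W`. -/
def wFactor (lam ξ : ℝ) : ℝ := Real.sqrt (2 * (2 * Real.pi) / ((lam + 1) * V (2 * ξ) (-lam / 2)))

lemma V_pos' {lam : ℝ} (hlam : -1 < lam) (ξ : ℝ) : 0 < V (2 * ξ) (-lam / 2) :=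
  V_pos _ (by linarith)

lemma wFactor_pos {lam : ℝ} (hlam : -1 < lam) (ξ : ℝ) : 0 < wFactor lam ξ := by
  have h1 := V_pos' hlam ξ
  have h2 : 0 < lam + 1 := by linarith
  unfold wFactor
  positivity

lemma wFactor_sq {lam : ℝ} (hlam : -1 < lam) (ξ : ℝ) :
    cConst lam / 4 * wFactor lam ξ ^ 2 = (V (2 * ξ) (-lam / 2))⁻¹ := by
  have h1 := V_pos' hlam ξ
  have h2 : 0 < lam + 1 := by linarith
  rw [wFactor, Real.sq_sqrt (by positivity), cConst]
  generalize V (2 * ξ) (-lam / 2) = v at *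
  field_simp
  norm_num

lemma measurable_V (β : ℝ) : Measurable fun ξ => V (2 * ξ) β :=
  (StronglyMeasurable.integral_prod_right' (measurable_rrWeight β).stronglyMeasurable).measurable

lemma measurable_wFactor (lam : ℝ) : Measurable (wFactor lam) := by
  have := measurable_V (-lam / 2)
  unfold wFactor
  fun_prop

lemma coeFn_W (lam : ℝ) [hlam : Fact (-1 < lam)] (ψ : Lp ℂ 2 (volume : Measure ℝ)) :
    W lam ψ =ᵐ[rhoF lam] fun p => (wFactor lam p.1 : ℂ) * ψ p.1 :=
  coeFn_isometryOfFun _ _ _ _ _ _ ψ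

lemma coeFn_U2 (lam : ℝ) (φ : Lp ℂ 2 (rho lam)) :
    U2 lam φ =ᵐ[rhoF lam] fun p => φ p / F lam p :=
  coeFn_isometryOfFun _ _ _ _ _ _ φ

/-- The norm identity of `W` for functions not yet known to be square integrable; it is used to
deduce square integrability of `ψ` from that of its image. -/
lemma lintegral_rhoF_wFactor {lam : ℝ} (hlam : -1 < lam) {ψ : ℝ → ℂ} (hψ : Measurable ψ) :
    ∫⁻ p, ‖(wFactor lam p.1 : ℂ) * ψ p.1‖ₑ ^ 2 ∂(rhoF lam) = ∫⁻ ξ, ‖ψ ξ‖ₑ ^ 2 := by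
  have hβ : -lam / 2 < 1 / 2 := by linarith
  have hw := measurable_wFactor lam
  have hF := measurable_F lam
  have hm : Measurable fun p => ENNReal.ofReal (‖F lam p‖ ^ 2) := by fun_prop
  have hc : 0 < cConst lam / 4 := div_pos (cConst_pos hlam) (by norm_num)
  rw [rhoF, lintegral_withDensity_eq_lintegral_mul _ hm (by fun_prop), rho,
    lintegral_prod _ (by fun_prop)]
  refine lintegral_congr fun ξ => ?_
  have hVp := V_pos' hlam ξ
  have e := wFactor_sq hlam ξ
  rw [lintegral_momentMeasure]
  simp only [Pi.mul_apply, norm_F_sq]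
  rw [lintegral_mul_const' _ _ (ENNReal.pow_ne_top enorm_ne_top),
    ← ofReal_integral_eq_lintegral_ofReal (integrable_rrWeight _ hβ)
      (Eventually.of_forall fun u => (rrWeight_pos _ _ u).le)]
  change _ * (ENNReal.ofReal (V (2 * ξ) (-lam / 2)) * _) = _
  rw [enorm_mul, mul_pow, ← ofReal_norm, ← ENNReal.ofReal_pow (norm_nonneg _), Complex.norm_real,
    Real.norm_eq_abs, sq_abs, ← mul_assoc, ← mul_assoc, ← ENNReal.ofReal_mul hc.le,
    ← ENNReal.ofReal_mul (by positivity), mul_right_comm, e, inv_mul_cancel₀ hVp.ne']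
  simp

/-- `U = U₂ ∘ U₁ ∘ U₀`. -/
def U (lam : ℝ) [Fact (-1 < lam)] : Lp ℂ 2 (vHat lam) →L[ℂ] Lp ℂ 2 (rhoF lam) :=
  (U2 lam).toContinuousLinearMap ∘L U1 lam ∘L (U0 lam).toContinuousLinearMap

lemma norm_U (lam : ℝ) [Fact (-1 < lam)] (f : Lp ℂ 2 (vHat lam)) : ‖U lam f‖ = ‖f‖ := by
  simp [U, norm_U1]

lemma R_eq (lam : ℝ) [Fact (-1 < lam)] :
    R lam = (W lam).toContinuousLinearMap.adjoint ∘L U lam := rfl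

/-- `U` maps a holomorphic function that decays in sectors to the range of `W`. -/
lemma exists_W_eq_U {lam : ℝ} [hlam : Fact (-1 < lam)] {g : ℂ → ℂ} (hg : DifferentiableOn ℂ g H)
    (hgm : Measurable g) (hd : HasSectorDecay lam g) (hg2 : MemLp g 2 (vHat lam)) :
    ∃ ψ : Lp ℂ 2 (volume : Measure ℝ), W lam ψ = U lam (hg2.toLp g) ∧
      ψ =ᵐ[volume] fun ξ => (((wFactor lam ξ)⁻¹ : ℝ) : ℂ) *
        (((Real.sqrt (2 * Real.pi))⁻¹ : ℂ) * rayIntegral lam g ξ) := by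
  set ψ : ℝ → ℂ := fun ξ => (((wFactor lam ξ)⁻¹ : ℝ) : ℂ) *
        (((Real.sqrt (2 * Real.pi))⁻¹ : ℂ) * rayIntegral lam g ξ) with hψ
  have hψm : Measurable ψ := by
    have := measurable_wFactor lam
    have := measurable_rayIntegral lam hgm
    fun_prop
  -- The division by `F` in `U₂` cancels the factor `F` produced by the contour shift; what remains
  -- depends on `ξ` only.
  have hU : U lam (hg2.toLp g) =ᵐ[rhoF lam] fun p => (wFactor lam p.1 : ℂ) * ψ p.1 := by
    filter_upwards [coeFn_U2 lam (U1 lam (U0 lam (hg2.toLp g))),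
      (withDensity_absolutelyContinuous _ _ : rhoF lam ≪ rho lam).ae_le
        (coeFn_U1_U0 hg hgm hd hg2)] with p h1 h2
    have h3 : (wFactor lam p.1 : ℂ) ≠ 0 := by exact_mod_cast (wFactor_pos hlam.out p.1).ne'
    have h4 := F_ne_zero lam p
    change U2 lam (U1 lam (U0 lam (hg2.toLp g))) p = _
    rw [h1, h2, mul_div_cancel_left₀ _ h4]
    simp only [hψ]
    push_cast
    rw [mul_inv_cancel_left₀ h3]
  have hψ2 : MemLp ψ 2 volume := by
    refine ⟨hψm.aestronglyMeasurable, ?_⟩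
    rw [← eLpNorm_two_eq_of_lintegral (lintegral_rhoF_wFactor hlam.out hψm),
      ← eLpNorm_congr_ae hU]
    exact Lp.eLpNorm_lt_top _
  refine ⟨hψ2.toLp ψ, Lp.ext ?_, hψ2.coeFn_toLp⟩
  have hq : Measure.QuasiMeasurePreserving Prod.fst (rhoF lam) volume :=
    (Measure.quasiMeasurePreserving_fst (μ := volume) (ν := momentMeasure lam)).mono_left
      (withDensity_absolutelyContinuous _ _)
  filter_upwards [coeFn_W lam (hψ2.toLp ψ), hU, hq.ae hψ2.coeFn_toLp] with p h1 h2 h3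
  rw [h1, h2, h3]

/-! ### Cutoffs, and the inclusion of `U(𝒜²)` in the range of `W`. -/

/-- A bounded holomorphic function on the half-plane that vanishes at `0` and at `∞` and tends to
`1` as `a → ∞`. -/
def cutoff (a : ℝ) (z : ℂ) : ℂ := z / (z + ((a⁻¹ : ℝ) : ℂ) * I) * (a * I / (z + a * I))

lemma add_mul_I_facts {z : ℂ} (hz : z ∈ H) {b : ℝ} (hb : 0 < b) :
    z + b * I ≠ 0 ∧ b ≤ ‖z + b * I‖ ∧ ‖z‖ ≤ ‖z + b * I‖ := by
  have hz : 0 < z.im := hz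
  have him : (z + b * I).im = z.im + b := by simp
  have hre : (z + b * I).re = z.re := by simp
  refine ⟨fun h => ?_, ?_, ?_⟩
  · rw [h] at him
    simp at him
    linarith
  · have := Complex.abs_im_le_norm (z + b * I)
    rw [him, abs_of_pos (by linarith)] at this
    linarith
  · rw [Complex.norm_eq_sqrt_sq_add_sq, Complex.norm_eq_sqrt_sq_add_sq, him, hre]
    apply Real.sqrt_le_sqrt
    nlinarith

lemma norm_cutoff_le {a : ℝ} (ha : 0 < a) {z : ℂ} (hz : z ∈ H) :
    ‖cutoff a z‖ ≤ 1 ∧ ‖cutoff a z‖ ≤ 2 * a * (‖z‖ / (1 + ‖z‖ ^ 2)) := by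
  obtain ⟨h1, h2, h3⟩ := add_mul_I_facts hz ha
  obtain ⟨k1, k2, k3⟩ := add_mul_I_facts hz (inv_pos.2 ha)
  have hp1 : 0 < ‖z + a * I‖ := norm_pos_iff.2 h1
  have hp2 : 0 < ‖z + ((a⁻¹ : ℝ) : ℂ) * I‖ := norm_pos_iff.2 k1
  have hn : ‖cutoff a z‖ = ‖z‖ / ‖z + ((a⁻¹ : ℝ) : ℂ) * I‖ * (a / ‖z + a * I‖) := by
    simp [cutoff, abs_of_pos ha]
  have hz0 := norm_nonneg z
  have A1 : ‖z‖ / ‖z + ((a⁻¹ : ℝ) : ℂ) * I‖ ≤ 1 := (div_le_one hp2).2 k3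
  have A2 : ‖z‖ / ‖z + ((a⁻¹ : ℝ) : ℂ) * I‖ ≤ a * ‖z‖ := by
    rw [div_le_iff₀ hp2]
    calc ‖z‖ = a * ‖z‖ * a⁻¹ := by field_simp
      _ ≤ _ := by gcongr
  have B1 : a / ‖z + a * I‖ ≤ 1 := (div_le_one hp1).2 h2
  have B2 : a / ‖z + a * I‖ * ‖z‖ ≤ a := by
    rw [div_mul_eq_mul_div, div_le_iff₀ hp1]
    gcongr
  have A0 : 0 ≤ ‖z‖ / ‖z + ((a⁻¹ : ℝ) : ℂ) * I‖ := by positivity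
  have B0 : 0 ≤ a / ‖z + a * I‖ := by positivity
  rw [hn]
  -- Both factors are at most `1`. In addition `A ≤ a |z|` handles `0` and `B |z| ≤ a` handles `∞`;
  -- summing the two bounds for `A B (1 + |z|²)` gives the constant `2 a`.
  generalize ‖z‖ / ‖z + ((a⁻¹ : ℝ) : ℂ) * I‖ = A at *
  generalize a / ‖z + a * I‖ = B at *
  refine ⟨mul_le_one₀ A1 B0 B1, ?_⟩
  rw [← mul_div_assoc, le_div_iff₀ (by positivity)]
  have C1 : A * B ≤ a * ‖z‖ := (mul_le_of_le_one_right A0 B1).trans A2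
  have C2 : A * B * ‖z‖ ≤ a := by
    rw [mul_assoc]
    exact (mul_le_of_le_one_left (by positivity) A1).trans B2
  nlinarith

lemma differentiableOn_cutoff {a : ℝ} (ha : 0 < a) : DifferentiableOn ℂ (cutoff a) H := by
  unfold cutoff
  refine DifferentiableOn.mul ?_ ?_
  · exact DifferentiableOn.div (by fun_prop) (by fun_prop)
      fun z hz => (add_mul_I_facts hz (inv_pos.2 ha)).1
  · exact DifferentiableOn.div (by fun_prop) (by fun_prop)
      fun z hz => (add_mul_I_facts hz ha).1

lemma measurable_cutoff (a : ℝ) : Measurable (cutoff a) := by unfold cutoff; fun_prop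

lemma tendsto_cutoff {z : ℂ} (hz : z ∈ H) :
    Tendsto (fun n : ℕ => cutoff (n + 1 : ℝ) z) atTop (𝓝 1) := by
  have hz0 : z ≠ 0 := by
    rintro rfl
    have : (0 : ℝ) < (0 : ℂ).im := hz
    simp at this
  have hi : Tendsto (fun n : ℕ => (((n + 1 : ℝ)⁻¹ : ℝ) : ℂ)) atTop (𝓝 0) := by
    have := tendsto_one_div_add_atTop_nhds_zero_nat (𝕜 := ℝ)
    simp only [one_div] at this
    exact_mod_cast (Complex.continuous_ofReal.tendsto 0).comp this
  have h1 : Tendsto (fun n : ℕ => z / (z + (((n + 1 : ℝ)⁻¹ : ℝ) : ℂ) * I)) atTop (𝓝 1) := by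
    have := (tendsto_const_nhds (x := z)).div ((tendsto_const_nhds (x := z)).add
      (hi.mul_const I)) (by simpa using hz0)
    simpa [hz0, Pi.div_def] using this
  -- The second factor of the cutoff, divided through by `a = n + 1`, so that the limit is visible.
  have h2 : Tendsto (fun n : ℕ => I / (z * (((n + 1 : ℝ)⁻¹ : ℝ) : ℂ) + I)) atTop (𝓝 1) := by
    have := (tendsto_const_nhds (x := I)).div ((hi.const_mul z).add
      (tendsto_const_nhds (x := I))) (by simp)
    simpa [Pi.div_def] using this
  have := h1.mul h2
  rw [mul_one] at this
  refine this.congr fun n => ?_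
  unfold cutoff
  congr 1
  have h0 : ((n + 1 : ℝ) : ℂ) ≠ 0 := by exact_mod_cast (Nat.cast_add_one_pos (α := ℝ) n).ne'
  have h3 := (add_mul_I_facts hz (Nat.cast_add_one_pos (α := ℝ) n)).1
  have e : z * (((n + 1 : ℝ)⁻¹ : ℝ) : ℂ) + I =
      (z + ((n + 1 : ℝ) : ℂ) * I) * ((n + 1 : ℝ) : ℂ)⁻¹ := by
    rw [Complex.ofReal_inv]; field_simp
  rw [e]
  field_simp

/-- In a sector `|z|` is at most a multiple of `Im z`, so the growth bound makes `|g| |z| ^ (λ/2 +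
1)` bounded; the cutoff supplies the decay. -/
lemma hasSectorDecay_mul_cutoff {lam : ℝ} (hlam : -1 < lam) {g : ℂ → ℂ}
    (hg : DifferentiableOn ℂ g H) (hgm : Measurable g) (hg2 : MemLp g 2 (vHat lam)) {a : ℝ}
    (ha : 0 < a) : HasSectorDecay lam (fun z => g z * cutoff a z) := by
  obtain ⟨C, hC0, hC⟩ := exists_norm_le_im_rpow hlam hg hgm hg2
  intro c
  have hl : 0 ≤ lam / 2 + 1 := by linarith
  refine ⟨C * (1 + |c|) ^ (lam / 2 + 1) * (2 * a), by positivity, fun z hz hzc => ?_⟩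
  have hz' : 0 < z.im := hz
  have h1 : ‖z‖ ≤ (1 + |c|) * z.im := by
    have := Complex.norm_le_abs_re_add_abs_im z
    rw [abs_of_pos hz'] at this
    nlinarith [le_abs_self c]
  have h2 : ‖z‖ ^ (lam / 2 + 1) ≤ (1 + |c|) ^ (lam / 2 + 1) * z.im ^ (lam / 2 + 1) := by
    rw [← Real.mul_rpow (by positivity) hz'.le]
    exact Real.rpow_le_rpow (norm_nonneg _) h1 hl
  have h3 : ‖g z‖ * ‖z‖ ^ (lam / 2 + 1) ≤ C * (1 + |c|) ^ (lam / 2 + 1) := by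
    calc _ ≤ C * z.im ^ (-(lam / 2 + 1)) * ((1 + |c|) ^ (lam / 2 + 1) * z.im ^ (lam / 2 + 1)) :=
          mul_le_mul (hC z hz) h2 (by positivity) (by positivity)
      _ = _ := by
          rw [Real.rpow_neg hz'.le]
          have := (Real.rpow_pos_of_pos hz' (lam / 2 + 1)).ne'
          field_simp
  rw [norm_mul]
  calc _ = ‖g z‖ * ‖z‖ ^ (lam / 2 + 1) * ‖cutoff a z‖ := by ring
    _ ≤ C * (1 + |c|) ^ (lam / 2 + 1) * (2 * a * (‖z‖ / (1 + ‖z‖ ^ 2))) :=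
        mul_le_mul h3 (norm_cutoff_le ha hz).2 (norm_nonneg _) (by positivity)
    _ = _ := by ring

lemma ae_vHat_mem (lam : ℝ) : ∀ᵐ z ∂(vHat lam), z ∈ H :=
  (vHat_absolutelyContinuous lam).ae_le
    (ae_restrict_mem UpperHalfPlane.isOpen_upperHalfPlaneSet.measurableSet)

lemma memLp_mul_cutoff {lam : ℝ} {g : ℂ → ℂ} (hgm : Measurable g) (hg2 : MemLp g 2 (vHat lam))
    {a : ℝ} (ha : 0 < a) : MemLp (fun z => g z * cutoff a z) 2 (vHat lam) := by
  have := measurable_cutoff a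
  refine hg2.mono (Measurable.aestronglyMeasurable (by fun_prop)) ?_
  filter_upwards [ae_vHat_mem lam] with z hz
  rw [norm_mul]
  exact mul_le_of_le_one_right (norm_nonneg _) (norm_cutoff_le ha hz).1

lemma tendsto_toLp_mul_cutoff {lam : ℝ} {g : ℂ → ℂ} (hgm : Measurable g)
    (hg2 : MemLp g 2 (vHat lam)) :
    Tendsto (fun n : ℕ => (memLp_mul_cutoff hgm hg2 (Nat.cast_add_one_pos n)).toLp _) atTop
      (𝓝 (hg2.toLp g)) := by
  rw [Lp.tendsto_Lp_iff_tendsto_eLpNorm'']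
  have hm := measurable_cutoff
  -- The dominating function: the cutoff has modulus at most `1`, so the difference has modulus at
  -- most `2 |g|`.
  have hfin : ∫⁻ z, 4 * ‖g z‖ₑ ^ 2 ∂(vHat lam) ≠ ∞ := by
    rw [lintegral_const_mul' _ _ (by norm_num)]
    refine ENNReal.mul_ne_top (by norm_num) ?_
    have := lintegral_Lp_ne_top (hg2.toLp g)
    rwa [lintegral_congr_ae (hg2.coeFn_toLp.mono fun z hz => by
      rw [hz])] at this
  have h := tendsto_lintegral_of_dominated_convergence' (μ := vHat lam)
    (F := fun (n : ℕ) z => ‖(fun z => g z * cutoff (n + 1) z) z - g z‖ₑ ^ 2) (f := fun _ => 0)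
    (fun z => 4 * ‖g z‖ₑ ^ 2) (fun n => by
      have := hm (n + 1)
      exact Measurable.aemeasurable (by fun_prop)) (fun n => by
      filter_upwards [ae_vHat_mem lam] with z hz
      have h1 : ‖g z * cutoff (n + 1) z - g z‖ ≤ 2 * ‖g z‖ := by
        refine (norm_sub_le _ _).trans ?_
        rw [norm_mul]
        have := mul_le_of_le_one_right (norm_nonneg (g z))
          (norm_cutoff_le (Nat.cast_add_one_pos n) hz).1
        linarith
      calc _ ≤ (ENNReal.ofReal (2 * ‖g z‖)) ^ 2 := by
            gcongr
            rw [← ofReal_norm]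
            exact ENNReal.ofReal_le_ofReal h1
        _ = _ := by
            rw [ENNReal.ofReal_mul (by norm_num), ofReal_norm, mul_pow]
            norm_num) hfin (by
      filter_upwards [ae_vHat_mem lam] with z hz
      have h1 : Tendsto (fun n : ℕ => g z * cutoff (n + 1) z - g z) atTop (𝓝 0) := by
        simpa using ((tendsto_cutoff hz).const_mul (g z)).sub_const (g z)
      have h2 := ((ENNReal.continuous_pow 2).tendsto _).comp h1.enorm
      simpa [Function.comp_def] using h2)
  rw [lintegral_zero] at h
  have h2 := h.ennrpow_const (1 / 2 : ℝ)
  rw [ENNReal.zero_rpow_of_pos (by norm_num)] at h2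
  refine h2.congr fun n => ?_
  rw [← eLpNorm_two_eq (f := fun z => (fun z => g z * cutoff (n + 1) z) z - g z)]
  rfl

lemma isClosed_range_W (lam : ℝ) [Fact (-1 < lam)] : IsClosed (range (W lam)) :=
  (W lam).isometry.isClosedEmbedding.isClosed_range

lemma exists_measurable_of_mem_bergman {lam : ℝ} {f : Lp ℂ 2 (vHat lam)} (hf : f ∈ bergman lam) :
    ∃ g : ℂ → ℂ, DifferentiableOn ℂ g H ∧ Measurable g ∧ f =ᵐ[vHat lam] g := by
  have hm : MeasurableSet H := UpperHalfPlane.isOpen_upperHalfPlaneSet.measurableSet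
  obtain ⟨g, hg, hfg⟩ := hf
  refine ⟨H.indicator g, hg.congr fun z hz => indicator_of_mem hz _, ?_, ?_⟩
  · rw [← piecewise_eq_indicator]
    exact hg.continuousOn.measurable_piecewise continuousOn_const hm
  · filter_upwards [hfg, ae_vHat_mem lam] with z h1 h2
    rw [h1, indicator_of_mem (s := H) h2]

/-- `U` maps the Bergman space into the range of `W`. -/
lemma U_mem_range_W {lam : ℝ} [hlam : Fact (-1 < lam)] {f : Lp ℂ 2 (vHat lam)}
    (hf : f ∈ bergman lam) : U lam f ∈ range (W lam) := by
  obtain ⟨g, hg, hgm, hfg⟩ := exists_measurable_of_mem_bergman hf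
  have hg2 : MemLp g 2 (vHat lam) := (memLp_congr_ae hfg).1 (Lp.memLp f)
  have hfe : f = hg2.toLp g := Lp.ext (hfg.trans hg2.coeFn_toLp.symm)
  rw [hfe]
  refine (isClosed_range_W lam).mem_of_tendsto (((U lam).continuous.tendsto _).comp
    (tendsto_toLp_mul_cutoff hgm hg2)) (Eventually.of_forall fun n => ?_)
  have hn : (0 : ℝ) < n + 1 := Nat.cast_add_one_pos n
  obtain ⟨ψ, hψ, -⟩ := exists_W_eq_U (hg.mul (differentiableOn_cutoff hn))
    (hgm.mul (measurable_cutoff _)) (hasSectorDecay_mul_cutoff hlam.out hg hgm hg2 hn)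
    (memLp_mul_cutoff hgm hg2 hn)
  exact ⟨ψ, hψ⟩

/-! ### Test functions with Gaussian Mellin transforms. -/

lemma norm_kappa (s h : ℝ) (hs : 0 < s) : ‖kappa (s, h)‖ = s * Real.sqrt (1 + h ^ 2) := by
  rw [kappa, norm_mul, Complex.norm_real, Real.norm_of_nonneg hs.le,
    Complex.norm_eq_sqrt_sq_add_sq]
  simp [add_comm]

/-- Put `r = √(1 + h²)` and `x = r s = |z|`. Then `s ^ (1 + λ) |g|²` is at most `r ^ (-(λ + 1)) C² /
(1 + x²)`, and the change of variable from `s` to `x` yields one more `r⁻¹`. The remaining weight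
`(1 + h²) ^ (-(λ/2 + 1))` is integrable as `λ > -1`. -/
lemma memLp_of_norm_mul_rpow_le {lam : ℝ} (hlam : -1 < lam) {g : ℂ → ℂ} (hgm : Measurable g)
    {C : ℝ} (hC : ∀ z ∈ H, ‖g z‖ * ‖z‖ ^ (lam / 2 + 1) ≤ C * (‖z‖ / (1 + ‖z‖ ^ 2))) :
    MemLp g 2 (vHat lam) := by
  have hk := measurable_kappa
  refine ⟨hgm.aestronglyMeasurable, ?_⟩
  rw [eLpNorm_two_eq]
  refine ENNReal.rpow_lt_top_of_nonneg (by norm_num) ?_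
  rw [← (measurePreserving_kappa hlam).lintegral_comp (hgm.enorm.pow_const 2),
    lintegral_nuHat lam (by fun_prop)]
  refine ENNReal.mul_ne_top ENNReal.ofReal_ne_top ?_
  rw [baseMeasure, lintegral_prod_symm _ (by fun_prop)]
  have key : ∀ h : ℝ, ∫⁻ s in Ioi (0 : ℝ),
      ENNReal.ofReal (s ^ (1 + lam)) * ‖g (kappa (s, h))‖ₑ ^ 2 ≤
      ENNReal.ofReal (rrWeight 0 (-lam / 2) h) *
        ENNReal.ofReal (∫ s in Ioi (0 : ℝ), C ^ 2 * (1 + s ^ 2)⁻¹) := by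
    intro h
    set r := Real.sqrt (1 + h ^ 2) with hr
    have hp : (0 : ℝ) < 1 + h ^ 2 := by positivity
    have hr0 : 0 < r := Real.sqrt_pos.2 hp
    have hrr : rrWeight 0 (-lam / 2) h = r ^ (-(lam + 1)) * r⁻¹ := by
      rw [rrWeight, hr, Real.sqrt_eq_rpow, ← Real.rpow_neg_one, ← Real.rpow_mul hp.le,
        ← Real.rpow_mul hp.le, ← Real.rpow_add hp, div_eq_mul_inv, ← Real.rpow_neg hp.le]
      simp only [neg_zero, zero_mul, Real.exp_zero, one_mul]
      congr 1; ring
    rw [ofReal_integral_eq_lintegral_ofReal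
      (integrable_inv_one_add_sq.const_mul _).integrableOn
      (Eventually.of_forall fun s => by positivity),
      ← lintegral_Ioi_comp_mul hr0 (fun s => ENNReal.ofReal (C ^ 2 * (1 + s ^ 2)⁻¹)), ← mul_assoc, ← ENNReal.ofReal_mul (rrWeight_pos _ _ _).le,
      hrr, inv_mul_cancel_right₀ hr0.ne', ← lintegral_const_mul' _ _ ENNReal.ofReal_ne_top]
    refine setLIntegral_mono' measurableSet_Ioi fun s hs => ?_
    have hs : 0 < s := hs
    have h1 := hC _ (kappa_mem (p := (s, h)) hs)
    rw [norm_kappa s h hs, ← hr, mul_comm s r] at h1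
    rw [← ofReal_norm, ← ENNReal.ofReal_pow (norm_nonneg _), ← ENNReal.ofReal_mul (by positivity),
      ← ENNReal.ofReal_mul (by positivity)]
    refine ENNReal.ofReal_le_ofReal ?_
    set x := r * s with hx
    have hx0 : 0 < x := by positivity
    have hg0 := norm_nonneg (g (kappa (s, h)))
    set G := ‖g (kappa (s, h))‖ with hG
    have h2 : (G * x ^ (lam / 2 + 1)) ^ 2 ≤ (C * (x / (1 + x ^ 2))) ^ 2 :=
      pow_le_pow_left₀ (by positivity) h1 2
    have e1 : (x ^ (lam / 2 + 1)) ^ 2 = r ^ (lam + 1) * s ^ (1 + lam) * x := by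
      rw [← Real.rpow_mul_natCast hx0.le, show (lam / 2 + 1) * (2 : ℕ) = (lam + 1) + 1 by
        push_cast; ring, Real.rpow_add hx0, Real.rpow_one, hx, Real.mul_rpow hr0.le hs.le,
        add_comm 1 lam]
    rw [mul_pow, e1] at h2
    have hrl := Real.rpow_pos_of_pos hr0 (lam + 1)
    rw [Real.rpow_neg hr0.le, inv_mul_eq_div, le_div_iff₀ hrl]
    refine le_of_mul_le_mul_right (a := x) ?_ hx0
    calc _ = G ^ 2 * (r ^ (lam + 1) * s ^ (1 + lam) * x) := by ring
      _ ≤ _ := h2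
      _ = C ^ 2 * (1 + x ^ 2)⁻¹ * (x * (x / (1 + x ^ 2))) := by ring
      _ ≤ C ^ 2 * (1 + x ^ 2)⁻¹ * (x * 1) := by
          gcongr
          rw [div_le_one (by positivity)]
          nlinarith [sq_nonneg (x - 1)]
      _ = _ := by ring
  refine ((lintegral_mono key).trans_lt ?_).ne
  rw [lintegral_mul_const' _ _ ENNReal.ofReal_ne_top]
  refine ENNReal.mul_lt_top ?_ ENNReal.ofReal_lt_top
  exact (integrable_rrWeight 0 (β := -lam / 2) (by linarith)).lintegral_lt_top

/-- The holomorphic function `z ^ (-(λ/2 + 1)) exp (-(log z - t)²)` on the half-plane. -/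
def logGaussian (lam t : ℝ) (z : ℂ) : ℂ :=
  exp (-((lam : ℂ) / 2 + 1) * log z - (log z - t) ^ 2)

lemma measurable_logGaussian (lam t : ℝ) : Measurable (logGaussian lam t) := by
  unfold logGaussian
  have := Complex.measurable_log
  fun_prop

lemma differentiableOn_logGaussian (lam t : ℝ) : DifferentiableOn ℂ (logGaussian lam t) H := by
  have : DifferentiableOn ℂ log H := fun z hz =>
    (Complex.differentiableAt_log (Or.inr (ne_of_gt (show 0 < z.im from hz)))).differentiableWithinAt
  unfold logGaussian
  fun_prop

/-- With `x = log |z|` the left side is `exp (-(x - t)² + (arg z)²)`. The argument is bounded, and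
the Gaussian in `x` beats both `exp x` and `exp (-x)`; the `1 / 4` comes from completing the square.
-/
lemma norm_logGaussian_le (lam t : ℝ) {z : ℂ} (hz : z ∈ H) :
    ‖logGaussian lam t z‖ * ‖z‖ ^ (lam / 2 + 1) ≤
      2 * Real.exp (Real.pi ^ 2 + 1 / 4 + |t|) * (‖z‖ / (1 + ‖z‖ ^ 2)) := by
  have hz0 : z ≠ 0 := by
    rintro rfl
    have : (0 : ℝ) < (0 : ℂ).im := hz
    simp at this
  have hn : 0 < ‖z‖ := norm_pos_iff.2 hz0
  set x := Real.log ‖z‖ with hx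
  have hex : ‖z‖ = Real.exp x := (Real.exp_log hn).symm
  have e1 : ‖logGaussian lam t z‖ * ‖z‖ ^ (lam / 2 + 1) =
      Real.exp (-(x - t) ^ 2 + z.arg ^ 2) := by
    rw [logGaussian, Complex.norm_exp, hex, ← Real.exp_mul, ← Real.exp_add]
    congr 1
    simp [pow_two, Complex.log_re, Complex.log_im, ← hx]
    ring
  have harg : z.arg ^ 2 ≤ Real.pi ^ 2 := sq_le_sq' (by linarith [Complex.neg_pi_lt_arg z])
    (Complex.arg_le_pi z)
  rw [e1, hex, ← mul_div_assoc, le_div_iff₀ (by positivity)]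
  have a1 : Real.exp (-(x - t) ^ 2 + z.arg ^ 2) ≤
      Real.exp (Real.pi ^ 2 + 1 / 4 + |t|) * Real.exp x := by
    rw [← Real.exp_add]
    refine Real.exp_le_exp.2 ?_
    nlinarith [sq_nonneg (x - t + 1 / 2), neg_abs_le t]
  have a2 : Real.exp (-(x - t) ^ 2 + z.arg ^ 2) * Real.exp x ^ 2 ≤
      Real.exp (Real.pi ^ 2 + 1 / 4 + |t|) * Real.exp x := by
    rw [← Real.exp_add, ← Real.exp_nat_mul, ← Real.exp_add]
    refine Real.exp_le_exp.2 ?_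
    push_cast
    nlinarith [sq_nonneg (x - t - 1 / 2), le_abs_self t]
  linarith

lemma hasSectorDecay_logGaussian (lam t : ℝ) : HasSectorDecay lam (logGaussian lam t) :=
  fun _ => ⟨_, by positivity, fun _ hz _ => norm_logGaussian_le lam t hz⟩

lemma memLp_logGaussian {lam : ℝ} (hlam : -1 < lam) (t : ℝ) :
    MemLp (logGaussian lam t) 2 (vHat lam) :=
  memLp_of_norm_mul_rpow_le hlam (measurable_logGaussian lam t)
    fun _ hz => norm_logGaussian_le lam t hz

/-- The power `z ^ (-(λ/2 + 1))` cancels the Mellin weight, leaving the Fourier integral of a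
Gaussian. The centre `t` survives only as the modulation `exp (-itξ)`. -/
lemma rayIntegral_logGaussian (lam t ξ : ℝ) :
    rayIntegral lam (logGaussian lam t) ξ =
      (Real.pi : ℂ) ^ (1 / 2 : ℂ) * exp (-(t * ξ : ℝ) * I) * (Real.exp (-ξ ^ 2 / 4) : ℝ) := by
  set b : ℂ := (Real.pi / 2 : ℝ) * I with hb
  have h1 : ∀ x : ℝ, logGaussian lam t (exp (x + b)) * exp (((lam : ℂ) / 2 + 1 - I * ξ) * (x + b)) =
      exp (-1 * (x : ℂ) ^ 2 + (-2 * (b - t) - I * ξ) * x + (-(b - t) ^ 2 - I * ξ * b)) := by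
    intro x
    have hl : log (exp (x + b)) = x + b := by
      refine Complex.log_exp ?_ ?_ <;> simp [hb] <;> linarith [Real.pi_pos]
    rw [logGaussian, hl, ← Complex.exp_add]
    congr 1; ring
  rw [rayIntegral]
  simp only [← hb, h1]
  rw [integral_cexp_quadratic (by simp), neg_neg, div_one, mul_assoc ((Real.pi : ℂ) ^ (1 / 2 : ℂ))]
  congr 1
  rw [Complex.ofReal_exp, ← Complex.exp_add]
  congr 1
  push_cast
  linear_combination ((ξ : ℂ) ^ 2 / 4) * Complex.I_sq

lemma V_le (lam ξ : ℝ) (hlam : -1 < lam) :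
    V (2 * ξ) (-lam / 2) ≤ Real.exp (2 * Real.pi * |ξ|) * V 0 (-lam / 2) := by
  have hβ : -lam / 2 < 1 / 2 := by linarith
  unfold V
  rw [← integral_const_mul]
  refine integral_mono (integrable_rrWeight _ hβ) ((integrable_rrWeight _ hβ).const_mul _)
    fun u => ?_
  simp only [rrWeight, neg_zero, zero_mul, Real.exp_zero, ← mul_div_assoc, mul_one]
  refine div_le_div_of_nonneg_right (Real.exp_le_exp.2 ?_) (by positivity)
  have h1 := arccot_pos u
  have h2 := arccot_lt_pi u
  have h3 := neg_abs_le ξ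
  have h4 := abs_nonneg ξ
  nlinarith [mul_nonneg h4 (sub_nonneg.2 h2.le), mul_nonneg (neg_le_iff_add_nonneg.1 h3) h1.le]

lemma wFactor_inv_sq {lam : ℝ} (hlam : -1 < lam) (ξ : ℝ) :
    (wFactor lam ξ)⁻¹ ^ 2 = cConst lam / 4 * V (2 * ξ) (-lam / 2) := by
  have h := wFactor_sq hlam ξ
  have h1 := V_pos' hlam ξ
  have h2 := wFactor_pos hlam ξ
  generalize V (2 * ξ) (-lam / 2) = v at *
  field_simp at h ⊢
  linarith

/-- `V(2ξ, ·)` grows at most exponentially because `arccot` is bounded by `π`, so half of the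
Gaussian exponent absorbs it: `2π|ξ| - ξ²/2 ≤ 4π² - ξ²/4`. -/
lemma wFactor_inv_mul_exp_sq_le {lam : ℝ} (hlam : -1 < lam) (ξ : ℝ) :
    ((wFactor lam ξ)⁻¹ * Real.exp (-ξ ^ 2 / 4)) ^ 2 ≤
      cConst lam / 4 * V 0 (-lam / 2) * Real.exp (4 * Real.pi ^ 2) *
        Real.exp (-(1 / 4) * ξ ^ 2) := by
  have hc := cConst_pos hlam
  have hV0 : 0 < V 0 (-lam / 2) := V_pos _ (by linarith)
  rw [mul_pow, wFactor_inv_sq hlam, ← Real.exp_nat_mul]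
  calc _ ≤ cConst lam / 4 * (Real.exp (2 * Real.pi * |ξ|) * V 0 (-lam / 2)) *
        Real.exp ((2 : ℕ) * (-ξ ^ 2 / 4)) := by
        gcongr
        exact V_le lam ξ hlam
    _ = cConst lam / 4 * V 0 (-lam / 2) *
        Real.exp (2 * Real.pi * |ξ| + (2 : ℕ) * (-ξ ^ 2 / 4)) := by
        rw [Real.exp_add]; ring
    _ ≤ cConst lam / 4 * V 0 (-lam / 2) *
        Real.exp (4 * Real.pi ^ 2 + -(1 / 4) * ξ ^ 2) := by
        refine mul_le_mul_of_nonneg_left (Real.exp_le_exp.2 ?_) (by positivity)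
        push_cast
        nlinarith [sq_nonneg (|ξ| / 2 - 2 * Real.pi), sq_abs ξ]
    _ = _ := by rw [Real.exp_add]; ring

open FourierTransform in
/-- A function in `L²(ℝ)` whose product with a bounded positive function in `L²(ℝ)` has vanishing
Fourier transform is zero. -/
lemma ae_eq_zero_of_forall_integral_exp_eq_zero {D : ℝ → ℝ} (hD0 : ∀ ξ, 0 < D ξ) {M : ℝ} (hDM : ∀ ξ, D ξ ≤ M) (hD2 : MemLp D 2 volume)
    {η : ℝ → ℂ} (hη : MemLp η 2 volume)
    (h : ∀ t : ℝ, ∫ ξ : ℝ, exp ((t * ξ : ℝ) * I) * ((D ξ : ℂ) * η ξ) = 0) :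
    η =ᵐ[volume] 0 := by
  set q : ℝ → ℂ := fun ξ => (D ξ : ℂ) * η ξ with hq
  -- Square integrability of `D` puts the product in `L¹`, its boundedness puts it in `L²`; the
  -- Plancherel identity needs both.
  have hq1 : Integrable q := MemLp.integrable_mul hD2.ofReal hη
  have hq2 : MemLp q 2 := by
    refine hη.of_le_mul (c := M) hq1.1 (Eventually.of_forall fun ξ => ?_)
    simp only [hq]
    rw [norm_mul, Complex.norm_real, Real.norm_of_nonneg (hD0 ξ).le]
    exact mul_le_mul_of_nonneg_right (hDM ξ) (norm_nonneg _)
  have hF : ∀ y, 𝓕 q y = 0 := fun y => by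
    rw [Real.fourier_eq', ← h (-2 * Real.pi * y)]
    refine integral_congr_ae (Eventually.of_forall fun ξ => ?_)
    simp only [smul_eq_mul, hq]
    congr 3
    simp
    ring
  have := lintegral_fourier_sq hq1 hq2
  simp only [hF, enorm_zero] at this
  rw [eq_comm] at this
  simp only [ne_eq, OfNat.ofNat_ne_zero, not_false_eq_true, zero_pow, lintegral_zero] at this
  rw [lintegral_eq_zero_iff' (hq1.1.enorm.pow_const 2)] at this
  filter_upwards [this] with ξ hξ
  have h0 : (D ξ : ℂ) ≠ 0 := by exact_mod_cast (hD0 ξ).ne'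
  simpa [hq, h0] using hξ

/-! ### `R` as a partial isometry. -/

lemma R_eq_of_W_eq {lam : ℝ} [Fact (-1 < lam)] {f : Lp ℂ 2 (vHat lam)}
    {ψ : Lp ℂ 2 (volume : Measure ℝ)} (h : W lam ψ = U lam f) : R lam f = ψ := by
  rw [R_eq, ContinuousLinearMap.comp_apply, ← h]
  refine ext_inner_right ℂ fun η => ?_
  rw [ContinuousLinearMap.adjoint_inner_left]
  exact (W lam).inner_map_map ψ η

lemma W_R {lam : ℝ} [Fact (-1 < lam)] {f : Lp ℂ 2 (vHat lam)} (hf : f ∈ bergman lam) :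
    W lam (R lam f) = U lam f := by
  obtain ⟨ψ, hψ⟩ := U_mem_range_W hf
  rw [R_eq_of_W_eq hψ, hψ]

/-- `R` restricted to the Bergman space, as an isometry. -/
def bergmanR (lam : ℝ) [Fact (-1 < lam)] : bergman lam →ₗᵢ[ℂ] Lp ℂ 2 (volume : Measure ℝ) where
  toLinearMap := (R lam).toLinearMap ∘ₗ (bergman lam).subtype
  norm_map' f := by
    change ‖R lam f‖ = ‖(f : Lp ℂ 2 (vHat lam))‖
    rw [← (W lam).norm_map, W_R f.2, norm_U]

/-- The images of the log-Gaussians are `k exp (-itξ) D(ξ)` with `D > 0` and `k ≠ 0`. Orthogonality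
of `η` to all of them says that the Fourier transform of `D η` vanishes identically. -/
lemma orthogonal_range_bergmanR (lam : ℝ) [hlam : Fact (-1 < lam)] :
    (LinearMap.range (bergmanR lam).toLinearMap)ᗮ = ⊥ := by
  rw [Submodule.eq_bot_iff]
  intro η hη
  rw [Submodule.mem_orthogonal] at hη
  set D : ℝ → ℝ := fun ξ => (wFactor lam ξ)⁻¹ * Real.exp (-ξ ^ 2 / 4) with hD
  have hwm := measurable_wFactor lam
  have hDm : Measurable D := by fun_prop
  have hD0 : ∀ ξ, 0 < D ξ := fun ξ =>
    mul_pos (inv_pos.2 (wFactor_pos hlam.out ξ)) (Real.exp_pos _)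
  set K := cConst lam / 4 * V 0 (-lam / 2) * Real.exp (4 * Real.pi ^ 2) with hK
  have hV0 : 0 < V 0 (-lam / 2) := V_pos _ (by linarith [hlam.out])
  have hK0 : 0 < K := by have := cConst_pos hlam.out; positivity
  have hDsq : ∀ ξ, D ξ ^ 2 ≤ K * Real.exp (-(1 / 4) * ξ ^ 2) :=
    wFactor_inv_mul_exp_sq_le hlam.out
  have hDM : ∀ ξ, D ξ ≤ Real.sqrt K := fun ξ => by
    refine Real.le_sqrt_of_sq_le ((hDsq ξ).trans ?_)
    refine mul_le_of_le_one_right hK0.le (Real.exp_le_one_iff.2 ?_)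
    nlinarith [sq_nonneg ξ]
  have hD2 : MemLp D 2 volume := by
    rw [memLp_two_iff_integrable_sq hDm.aestronglyMeasurable]
    refine ((integrable_exp_neg_mul_sq (b := 1 / 4) (by norm_num)).const_mul K).mono'
      (hDm.pow_const 2).aestronglyMeasurable (Eventually.of_forall fun ξ => ?_)
    rw [Real.norm_of_nonneg (by positivity)]
    exact hDsq ξ
  refine (Lp.eq_zero_iff_ae_eq_zero).2
    (ae_eq_zero_of_forall_integral_exp_eq_zero hD0 hDM hD2 (Lp.memLp η) fun t => ?_)
  have hg2 := memLp_logGaussian hlam.out t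
  obtain ⟨ψ, hψ, hψae⟩ := exists_W_eq_U (differentiableOn_logGaussian lam t)
    (measurable_logGaussian lam t) (hasSectorDecay_logGaussian lam t) hg2
  have h0 := hη ψ ⟨⟨hg2.toLp _, _, differentiableOn_logGaussian lam t, hg2.coeFn_toLp⟩,
    R_eq_of_W_eq hψ⟩
  rw [L2.inner_def] at h0
  set k : ℂ := ((Real.sqrt (2 * Real.pi))⁻¹ : ℂ) * (Real.pi : ℂ) ^ (1 / 2 : ℂ) with hk
  have hk0 : k ≠ 0 := by
    refine mul_ne_zero (inv_ne_zero ?_) ?_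
    · exact_mod_cast (Real.sqrt_pos.2 (by positivity)).ne'
    · rw [Ne, Complex.cpow_eq_zero_iff]
      simp [Real.pi_ne_zero]
  have e : (starRingEnd ℂ k) * ∫ ξ : ℝ, exp ((t * ξ : ℝ) * I) * ((D ξ : ℂ) * η ξ) = 0 := by
    rw [← h0, ← integral_const_mul]
    refine integral_congr_ae ?_
    filter_upwards [hψae] with ξ hξ
    simp only [RCLike.inner_apply]
    rw [hξ, rayIntegral_logGaussian]
    have e1 : (starRingEnd ℂ) (exp (-(t * ξ : ℝ) * I)) = exp ((t * ξ : ℝ) * I) := by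
      rw [← Complex.exp_conj]; simp
    simp only [map_mul, e1]
    simp only [map_mul, Complex.conj_ofReal, hD, hk, Complex.ofReal_mul]
    ring
  exact (mul_eq_zero.1 e).resolve_left (by simpa using hk0)

/-- `R` maps the Bergman space onto `L²(ℝ)`. -/
lemma exists_mem_bergman_R_eq {lam : ℝ} [Fact (-1 < lam)] (ψ : Lp ℂ 2 (volume : Measure ℝ)) :
    ∃ f ∈ bergman lam, R lam f = ψ := by
  have hc : IsClosed ((LinearMap.range (bergmanR lam).toLinearMap :
      Submodule ℂ (Lp ℂ 2 (volume : Measure ℝ))) : Set (Lp ℂ 2 (volume : Measure ℝ))) :=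
    (bergmanR lam).isometry.isClosedEmbedding.isClosed_range
  have h := (Submodule.topologicalClosure_eq_top_iff).2 (orthogonal_range_bergmanR lam)
  rw [hc.submodule_topologicalClosure_eq] at h
  have : ψ ∈ LinearMap.range (bergmanR lam).toLinearMap := by rw [h]; trivial
  obtain ⟨f, hf⟩ := this
  exact ⟨f, f.2, hf⟩

/-- Only `f` has to be holomorphic: for arbitrary `g`, `⟨R f, R g⟩ = ⟨W R f, U g⟩ = ⟨U f, U g⟩ = ⟨f,
g⟩`. -/
lemma adjoint_R_R {lam : ℝ} [Fact (-1 < lam)] {f : Lp ℂ 2 (vHat lam)} (hf : f ∈ bergman lam) :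
    (R lam).adjoint (R lam f) = f := by
  refine ext_inner_right ℂ fun g => ?_
  rw [ContinuousLinearMap.adjoint_inner_left]
  have h1 : inner ℂ (R lam f) (R lam g) = inner ℂ (W lam (R lam f)) (U lam g) := by
    rw [R_eq, ContinuousLinearMap.comp_apply, ContinuousLinearMap.comp_apply,
      ContinuousLinearMap.adjoint_inner_right]
    rfl
  let U' : Lp ℂ 2 (vHat lam) →ₗᵢ[ℂ] Lp ℂ 2 (rhoF lam) := ⟨(U lam).toLinearMap, norm_U lam⟩
  rw [h1, W_R hf]
  exact U'.inner_map_map f g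

lemma adjoint_R_mem (lam : ℝ) [Fact (-1 < lam)] (ψ : Lp ℂ 2 (volume : Measure ℝ)) :
    (R lam).adjoint ψ ∈ bergman lam := by
  obtain ⟨f, hf, rfl⟩ := exists_mem_bergman_R_eq (lam := lam) ψ
  rwa [adjoint_R_R hf]

lemma R_adjoint_R (lam : ℝ) [Fact (-1 < lam)] (ψ : Lp ℂ 2 (volume : Measure ℝ)) :
    R lam ((R lam).adjoint ψ) = ψ := by
  obtain ⟨f, hf, rfl⟩ := exists_mem_bergman_R_eq (lam := lam) ψ
  rw [adjoint_R_R hf]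

lemma U_adjoint_R (lam : ℝ) [Fact (-1 < lam)] (ψ : Lp ℂ 2 (volume : Measure ℝ)) :
    U lam ((R lam).adjoint ψ) = W lam ψ := by
  rw [← W_R (adjoint_R_mem lam ψ), R_adjoint_R]

/-- The range of `R*` lies in the Bergman space, so `R` kills the orthogonal complement. This is
what removes the projection from the Toeplitz operator. -/
lemma R_starProjection (lam : ℝ) [Fact (-1 < lam)] (f : Lp ℂ 2 (vHat lam)) :
    R lam ((bergman lam).starProjection f) = R lam f := by
  rw [← sub_eq_zero, ← map_sub]
  refine ext_inner_right ℂ fun ψ => ?_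
  rw [inner_zero_left, ← ContinuousLinearMap.adjoint_inner_right, ← neg_sub, inner_neg_left,
    (Submodule.mem_orthogonal' _ _).1 ((bergman lam).sub_starProjection_mem_orthogonal f) _
      (adjoint_R_mem lam ψ), neg_zero]

lemma adjoint_R_comp_R (lam : ℝ) [Fact (-1 < lam)] :
    (R lam).adjoint ∘L R lam = (bergman lam).starProjection := by
  ext1 f
  rw [ContinuousLinearMap.comp_apply, ← R_starProjection,
    adjoint_R_R ((bergman lam).starProjection_apply_mem f)]

/-! ### Transport of the symbol and the spectral function. -/

lemma memLp_top_of_comp_div {a : ℂ → ℂ} (ha : MemLp a ∞ (volume.restrict H)) {f : ℝ → ℂ}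
    (hf : Measurable f) (haf : ∀ᵐ z ∂(volume.restrict H), a z = f (z.re / z.im)) :
    MemLp f ∞ volume := by
  obtain ⟨C, -, hC⟩ := memLp_top_exists_bound ha
  refine memLp_top_of_bound hf.aestronglyMeasurable C ?_
  have h1 : ∀ᵐ z ∂(volume.restrict H), ‖f (z.re / z.im)‖ ≤ C := by
    filter_upwards [hC, haf] with z h1 h2
    rwa [← h2]
  have hne : NeZero (volume.restrict (Ioi (0 : ℝ))) := ⟨by
    intro h
    simp at h⟩
  -- For almost every `h` the bound holds at almost every point of the ray through `h + i`; a single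
  -- such point bounds `f(h)`.
  filter_upwards [ae_base_swap (ae_H_iff_ae_base.1 h1)] with x hx
  obtain ⟨s, hs, hs0⟩ := (hx.and (ae_restrict_mem measurableSet_Ioi)).exists
  have e : (kappa (s, x)).re / (kappa (s, x)).im = x :=
    congrArg Prod.snd (momentCoord_kappa (p := (s, x)) hs0)
  rwa [e] at hs

lemma U0_mulOp {lam : ℝ} [hlam : Fact (-1 < lam)] {a : ℂ → ℂ}
    (ha : MemLp a ∞ (volume.restrict H)) {f : ℝ → ℂ} (hf : MemLp f ∞ volume)
    (haf : ∀ᵐ z ∂(volume.restrict H), a z = f (z.re / z.im)) (g : Lp ℂ 2 (vHat lam)) :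
    U0 lam (mulOp a (memLp_vHat ha lam) g) =
      mulOp _ (memLp_top_comp (quasiMeasurePreserving_snd_nuHat lam) hf) (U0 lam g) := by
  refine Lp.ext ?_
  filter_upwards [coeFn_U0 lam (mulOp a (memLp_vHat ha lam) g), coeFn_U0 lam g,
    coeFn_mulOp _ (memLp_top_comp (quasiMeasurePreserving_snd_nuHat lam) hf) (U0 lam g),
    (measurePreserving_kappa hlam.out).quasiMeasurePreserving.ae
      (coeFn_mulOp a (memLp_vHat ha lam) g), (ae_H_iff_ae_nuHat hlam.out).1 haf,
    ae_nuHat_pos lam] with p h1 h2 h3 h4 h5 h6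
  have e : (kappa p).re / (kappa p).im = p.2 := congrArg Prod.snd (momentCoord_kappa h6)
  rw [h1, h3, h4, h5, h2, e]

lemma U2_mulOp {lam : ℝ} {f : ℝ → ℂ} (hf : MemLp f ∞ volume) (φ : Lp ℂ 2 (rho lam)) :
    U2 lam (mulOp _ (memLp_top_comp (quasiMeasurePreserving_snd_rho lam) hf) φ) =
      mulOp _ (memLp_top_comp (quasiMeasurePreserving_snd_rhoF lam) hf) (U2 lam φ) := by
  refine Lp.ext ?_
  have hac : rhoF lam ≪ rho lam := withDensity_absolutelyContinuous _ _
  filter_upwards [coeFn_U2 lam (mulOp _ (memLp_top_comp (quasiMeasurePreserving_snd_rho lam) hf) φ),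
    coeFn_U2 lam φ, hac.ae_le
      (coeFn_mulOp _ (memLp_top_comp (quasiMeasurePreserving_snd_rho lam) hf) φ),
    coeFn_mulOp _ (memLp_top_comp (quasiMeasurePreserving_snd_rhoF lam) hf) (U2 lam φ)]
    with p h1 h2 h3 h4
  rw [h1, h4, h2, h3, mul_div_assoc]

/-- `U` intertwines multiplication by `f(Re z / Im z)` and by `f(u)`. -/
lemma U_mulOp {lam : ℝ} [Fact (-1 < lam)] {a : ℂ → ℂ}
    (ha : MemLp a ∞ (volume.restrict H)) {f : ℝ → ℂ} (hf : MemLp f ∞ volume)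
    (haf : ∀ᵐ z ∂(volume.restrict H), a z = f (z.re / z.im)) (g : Lp ℂ 2 (vHat lam)) :
    U lam (mulOp a (memLp_vHat ha lam) g) =
      mulOp _ (memLp_top_comp (quasiMeasurePreserving_snd_rhoF lam) hf) (U lam g) := by
  change U2 lam (U1 lam (U0 lam _)) = mulOp _ _ (U2 lam (U1 lam (U0 lam g)))
  rw [U0_mulOp ha hf haf, U1_mulOp hf, U2_mulOp hf]

lemma exp_div_eq_rrWeight (lam ξ u : ℝ) :
    Real.exp (-2 * ξ * arccot u) / (1 + u ^ 2) ^ (lam / 2 + 1) =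
      rrWeight (2 * ξ) (-lam / 2) u := by
  unfold rrWeight
  congr 2 <;> ring

lemma integrable_rrWeight_mul {f : ℝ → ℂ} (hf : MemLp f ∞ volume) {lam : ℝ} (hlam : -1 < lam)
    (ξ : ℝ) : Integrable fun u : ℝ => ((rrWeight (2 * ξ) (-lam / 2) u : ℝ) : ℂ) * f u := by
  obtain ⟨C, -, hC⟩ := memLp_top_exists_bound hf
  exact (integrable_rrWeight (2 * ξ) (β := -lam / 2) (by linarith)).ofReal.mul_bdd (c := C) hf.1 hC

lemma gamma_eq (f : ℝ → ℂ) (lam ξ : ℝ) : gamma f lam ξ = (((V (2 * ξ) (-lam / 2))⁻¹ : ℝ) : ℂ) *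
    ∫ u : ℝ, ((rrWeight (2 * ξ) (-lam / 2) u : ℝ) : ℂ) * f u := by
  simp only [gamma, exp_div_eq_rrWeight, one_div, Complex.ofReal_inv]

lemma measurable_gamma {f : ℝ → ℂ} (hf : Measurable f) (lam : ℝ) : Measurable (gamma f lam) := by
  have h1 := measurable_V (-lam / 2)
  have h2 : Measurable fun ξ : ℝ => ∫ u : ℝ, ((rrWeight (2 * ξ) (-lam / 2) u : ℝ) : ℂ) * f u := by
    refine (StronglyMeasurable.integral_prod_right' (f := fun p : ℝ × ℝ =>
      ((rrWeight (2 * p.1) (-lam / 2) p.2 : ℝ) : ℂ) * f p.2) ?_).measurable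
    have := measurable_rrWeight (-lam / 2)
    exact Measurable.stronglyMeasurable (by fun_prop)
  have e : gamma f lam = fun ξ => (((V (2 * ξ) (-lam / 2))⁻¹ : ℝ) : ℂ) *
    ∫ u : ℝ, ((rrWeight (2 * ξ) (-lam / 2) u : ℝ) : ℂ) * f u := funext (gamma_eq f lam)
  rw [e]
  fun_prop

lemma memLp_gamma {f : ℝ → ℂ} (hfm : Measurable f) (hf : MemLp f ∞ volume) {lam : ℝ}
    (hlam : -1 < lam) : MemLp (gamma f lam) ∞ volume := by
  obtain ⟨C, hC0, hC⟩ := memLp_top_exists_bound hf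
  refine memLp_top_of_bound (measurable_gamma hfm lam).aestronglyMeasurable C
    (Eventually.of_forall fun ξ => ?_)
  have hV := V_pos' hlam ξ
  rw [gamma_eq, norm_mul, Complex.norm_real, Real.norm_of_nonneg (inv_pos.2 hV).le,
    inv_mul_le_iff₀ hV]
  refine (norm_integral_le_of_norm_le
    ((integrable_rrWeight (2 * ξ) (β := -lam / 2) (by linarith)).mul_const C) ?_).trans
    (le_of_eq ?_)
  · filter_upwards [hC] with u hu
    rw [norm_mul, Complex.norm_real, Real.norm_of_nonneg (rrWeight_pos _ _ _).le]
    exact mul_le_mul_of_nonneg_left hu (rrWeight_pos _ _ _).le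
  · rw [integral_mul_const]; rfl

lemma integral_rhoF {lam : ℝ} (hlam : -1 < lam) {G : ℝ × ℝ → ℂ} (hG : Integrable G (rhoF lam)) :
    ∫ p, G p ∂(rhoF lam) = ∫ ξ : ℝ, ((cConst lam / 4 : ℝ) : ℂ) *
      ∫ u : ℝ, ((rrWeight (2 * ξ) (-lam / 2) u : ℝ) : ℂ) * G (ξ, u) := by
  have hF := measurable_F lam
  have hm : Measurable fun p => ENNReal.ofReal (‖F lam p‖ ^ 2) := by fun_prop
  have hc : 0 < cConst lam / 4 := div_pos (cConst_pos hlam) (by norm_num)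
  have hfin : ∀ᵐ p ∂(rho lam), ENNReal.ofReal (‖F lam p‖ ^ 2) < ∞ :=
    Eventually.of_forall fun _ => ENNReal.ofReal_lt_top
  rw [rhoF, integrable_withDensity_iff_integrable_smul' hm hfin] at hG
  rw [rhoF, integral_withDensity_eq_integral_toReal_smul hm hfin]
  rw [rho] at hG ⊢
  rw [integral_prod _ hG]
  refine integral_congr_ae (Eventually.of_forall fun ξ => ?_)
  simp only [momentMeasure]
  rw [integral_smul_measure, ENNReal.toReal_ofReal hc.le, Complex.real_smul]
  congr 1
  refine integral_congr_ae (Eventually.of_forall fun u => ?_)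
  simp only
  rw [ENNReal.toReal_ofReal (by positivity), norm_F_sq, Complex.real_smul]

/-- Elements of the range of `W` depend on `u` only through the measure, so in the inner product the
integral over `u` falls on `f` alone; `(c_λ / 4)` times the squared factor of `W` is `1 / V`. The
conjugates arise because the inner product is conjugate-linear in its first argument. -/
lemma adjoint_W_mulOp_W {lam : ℝ} [hlam : Fact (-1 < lam)] {f : ℝ → ℂ} (hfm : Measurable f)
    (hf : MemLp f ∞ volume) (ψ : Lp ℂ 2 (volume : Measure ℝ)) :
    (W lam).toContinuousLinearMap.adjoint
      (mulOp _ (memLp_top_comp (quasiMeasurePreserving_snd_rhoF lam) hf) (W lam ψ)) =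
      mulOp (gamma f lam) (memLp_gamma hfm hf hlam.out) ψ := by
  refine ext_inner_right ℂ fun η => ?_
  rw [ContinuousLinearMap.adjoint_inner_left]
  set X := mulOp _ (memLp_top_comp (quasiMeasurePreserving_snd_rhoF lam) hf) (W lam ψ) with hX
  change inner ℂ X (W lam η) = _
  set G : ℝ × ℝ → ℂ := fun p => (wFactor lam p.1 : ℂ) ^ 2 *
    ((starRingEnd ℂ) (f p.2) * ((starRingEnd ℂ) (ψ p.1) * η p.1)) with hG
  have hXG : (fun p => inner ℂ (X p) (W lam η p)) =ᵐ[rhoF lam] G := by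
    filter_upwards [coeFn_mulOp _ (memLp_top_comp (quasiMeasurePreserving_snd_rhoF lam) hf)
      (W lam ψ), coeFn_W lam ψ, coeFn_W lam η] with p h1 h2 h3
    rw [h1, h2, h3]
    simp only [RCLike.inner_apply, map_mul, Complex.conj_ofReal, hG]
    ring
  have hGi : Integrable G (rhoF lam) := (L2.integrable_inner (𝕜 := ℂ) X (W lam η)).congr hXG
  rw [L2.inner_def, L2.inner_def, integral_congr_ae hXG, integral_rhoF hlam.out hGi]
  refine integral_congr_ae ?_
  filter_upwards [coeFn_mulOp (gamma f lam) (memLp_gamma hfm hf hlam.out) ψ] with ξ h1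
  simp only [h1, RCLike.inner_apply, map_mul]
  have e : ∫ u : ℝ, ((rrWeight (2 * ξ) (-lam / 2) u : ℝ) : ℂ) * G (ξ, u) =
      (starRingEnd ℂ) (∫ u : ℝ, ((rrWeight (2 * ξ) (-lam / 2) u : ℝ) : ℂ) * f u) *
        ((wFactor lam ξ : ℂ) ^ 2 * ((starRingEnd ℂ) (ψ ξ) * η ξ)) := by
    rw [← integral_conj, ← integral_mul_const]
    refine integral_congr_ae (Eventually.of_forall fun u => ?_)
    simp only [hG, map_mul, Complex.conj_ofReal]
    ring
  rw [e, gamma_eq, map_mul, Complex.conj_ofReal, ← wFactor_sq hlam.out]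
  push_cast
  ring

end HyperbolicToeplitz

end

open MeasureTheory HyperbolicToeplitz
open scoped ENNReal
theorem mainTheorem6 (a : ℂ → ℂ) (ha : MemLp a ∞ (volume.restrict H))
    (hinv : IsHyperbolicSymbol a) :
    -- the symbol is a function of `Re z / Im z`
    (∃ f : ℝ → ℂ, Measurable f ∧ ∀ᵐ z ∂(volume.restrict H), a z = f (z.re / z.im)) ∧
    ∀ f : ℝ → ℂ, Measurable f → (∀ᵐ z ∂(volume.restrict H), a z = f (z.re / z.im)) →
    ∀ (lam : ℝ) [Fact (-1 < lam)],
      -- `R_λ` is a surjective partial isometry with initial space the Bergman space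
      ((R lam).adjoint ∘L R lam = (bergman lam).starProjection ∧
        R lam ∘L (R lam).adjoint = ContinuousLinearMap.id ℂ (Lp ℂ 2 (volume : Measure ℝ))) ∧
      -- the integrals converge, and the two expressions for the spectral function agree
      (∀ ξ : ℝ,
        Integrable (fun u : ℝ => Real.exp (-2 * ξ * arccot u) / (1 + u ^ 2) ^ (lam / 2 + 1)) ∧
        Integrable (fun u : ℝ =>
          ((Real.exp (-2 * ξ * arccot u) / (1 + u ^ 2) ^ (lam / 2 + 1) : ℝ) : ℂ) * f u) ∧
        0 < V (2 * ξ) (-lam / 2) ∧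
        gamma f lam ξ =
          (∫ u : ℝ, ((Real.exp (-2 * ξ * arccot u) / (1 + u ^ 2) ^ (lam / 2 + 1) : ℝ) : ℂ) * f u) /
          ((∫ u : ℝ, Real.exp (-2 * ξ * arccot u) / (1 + u ^ 2) ^ (lam / 2 + 1) : ℝ) : ℂ)) ∧
      -- `R_λ ∘ T_a ∘ R_λ*` is multiplication by the spectral function
      ∃ (hR : ∀ ψ, (R lam).adjoint ψ ∈ bergman lam) (hγ : MemLp (gamma f lam) ∞ volume),
        (R lam ∘L (bergman lam).subtypeL) ∘L toeplitz lam a ha ∘L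
          (R lam).adjoint.codRestrict (bergman lam) hR = mulOp (gamma f lam) hγ := by
  refine ⟨hinv.exists_eq_comp ha.1, fun f hfm haf lam hlam => ?_⟩
  have hf := memLp_top_of_comp_div ha hfm haf
  refine ⟨⟨adjoint_R_comp_R lam, ContinuousLinearMap.ext (R_adjoint_R lam)⟩, fun ξ => ?_,
    adjoint_R_mem lam, memLp_gamma hfm hf hlam.out, ContinuousLinearMap.ext fun ψ => ?_⟩
  · simp only [exp_div_eq_rrWeight]
    refine ⟨integrable_rrWeight _ (by linarith [hlam.out]),
      integrable_rrWeight_mul hf hlam.out ξ, V_pos' hlam.out ξ, ?_⟩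
    rw [gamma_eq, Complex.ofReal_inv]
    exact (div_eq_inv_mul _ _).symm
  · change R lam ((bergman lam).starProjection
      (mulOp a (memLp_vHat ha lam) ((R lam).adjoint ψ))) = _
    -- The chain is `R B M_a R* = R M_a R* = W* U M_a R* = W* M_f U R* = W* M_f W = M_γ`.
    rw [R_starProjection, R_eq, ContinuousLinearMap.comp_apply, U_mulOp ha hf haf, ← R_eq,
      U_adjoint_R, adjoint_W_mulOp_W hfm hf]
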